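/- Let $Q$ be a probability distribution on $\mathbb{R}$ with $\int x\,Q(dx)=0$, $\int x^2\,Q(dx)=\tfrac12$ and $b:=\int x^4\,Q(dx)<\infty$. For $N\ge 1$ let $X_N=(X_{ij})_{1\le i,j\le N}$ be the associated Hermitian Wigner matrix: $X_{ij}=X^{\mathrm{Re}}_{ij}+\mathbf{i}X^{\mathrm{Im}}_{ij}$ for $i<j$, $X_{ii}=\sqrt2\,X^{\mathrm{Re}}_{ii}$, and $X_{ij}=X^{\mathrm{Re}}_{ji}-\mathbf{i}X^{\mathrm{Im}}_{ji}$ for $i>j$, where $\{X^{\mathrm{Re}}_{ij}: i\le j\}\cup\{X^{\mathrm{Im}}_{ij}: i<j\}$ is a family of i.i.d. real random variables with distribution $Q$. Put $f_N(\mu,\nu):=\mathbb{E}\big(\det(X_N-\mu)\det(X_N-\nu)\big)$ for $\mu,\nu\in\mathbb{R}$. Then the expectations $f_N(\mu,\nu)$ exist, and for all $\mu,\nu\in\mathbb{R}$ $$\lim_{N\to\infty}\frac{f_N\big(2\sqrt N+\mu N^{-1/6},\,2\sqrt N+\nu N^{-1/6}\big)} {\sqrt{2\pi}\,N!\,N^{1/6}\exp\big(2N+(\mu+\nu)N^{1/3}\big)}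 =\exp\big(b-\tfrac34\big)\,\mathbb{A}(\mu,\nu),$$ where $\mathbb{A}$ is the Airy kernel $$\mathbb{A}(\mu,\nu)=\frac{\mathrm{Ai}(\mu)\,\mathrm{Ai}'(\nu)-\mathrm{Ai}'(\mu)\,\mathrm{Ai}(\nu)}{\mu-\nu} \quad(\mu\ne\nu),\qquad \mathbb{A}(\mu,\mu)=\mathrm{Ai}'(\mu)^2-\mu\,\mathrm{Ai}(\mu)^2,$$ which is continuous on $\mathbb{R}^2$, and $\mathrm{Ai}(x)=\frac1{2\pi i}\int_{1-i\infty}^{1+i\infty}\exp\big(\tfrac13z^3-xz\big)\,dz$ is the Airy function. -/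

import Mathlib

open MeasureTheory ProbabilityTheory Filter Topology

namespace WignerEdge

noncomputable section

/-- Labels of the independent real random variables that make up a Hermitian matrix of size `N`:
`Sum.inl (i, j)` with `i ≤ j` labels the real parts, `Sum.inr (i, j)` with `i < j` the imaginary
parts. -/
abbrev Index (N : ℕ) : Type :=
  {p : Fin N × Fin N // p.1 ≤ p.2} ⊕ {p : Fin N × Fin N // p.1 < p.2}

/-- The Hermitian matrix with real parts and imaginary parts of the entries above the diagonal
given by `x`, and with diagonal entries `√2 * x (i, i)`. -/
def hermitianMatrix {N : ℕ} (x : Index N → ℝ) : Matrix (Fin N) (Fin N) ℂ :=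
  Matrix.of fun i j =>
    if h : i < j then
      (x (Sum.inl ⟨(i, j), h.le⟩) : ℂ) + Complex.I * (x (Sum.inr ⟨(i, j), h⟩) : ℂ)
    else if h : j < i then
      (x (Sum.inl ⟨(j, i), h.le⟩) : ℂ) - Complex.I * (x (Sum.inr ⟨(j, i), h⟩) : ℂ)
    else
      (Real.sqrt 2 : ℂ) * (x (Sum.inl ⟨(i, i), le_rfl⟩) : ℂ)

/-- The (unnormalized) characteristic polynomial `det (X - t)` at the real point `t`. -/
def charDet {N : ℕ} (x : Index N → ℝ) (t : ℝ) : ℂ :=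
  (hermitianMatrix x - (t : ℂ) • (1 : Matrix (Fin N) (Fin N) ℂ)).det

/-- The second-order correlation function `E (D(s) D(t))` of the characteristic polynomial of the
random Hermitian matrix built from the random variables `ξ`. -/
def correlation {N : ℕ} {Ω : Type*} [MeasurableSpace Ω] (P : Measure Ω)
    (ξ : Index N → Ω → ℝ) (s t : ℝ) : ℂ :=
  ∫ ω, charDet (fun k => ξ k ω) s * charDet (fun k => ξ k ω) t ∂P

/-- The Airy function on the real line,
`Ai(x) = (1 / 2πi) ∫ exp (z ^ 3 / 3 - x z) dz` over the upward vertical line `Re z = 1`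
(an absolutely convergent integral, whose value is real by symmetry). -/
def airyAi (x : ℝ) : ℝ :=
  (1 / (2 * Real.pi)) *
    (∫ t : ℝ, Complex.exp ((1 + (t : ℂ) * Complex.I) ^ 3 / 3
      - (x : ℂ) * (1 + (t : ℂ) * Complex.I))).re

/-- The Airy kernel; on the diagonal it takes the value of its continuous extension,
`Ai'(x) ^ 2 - x Ai(x) ^ 2`. -/
def airyKernel (x y : ℝ) : ℝ :=
  if x = y then (deriv airyAi x) ^ 2 - x * (airyAi x) ^ 2
  else (airyAi x * deriv airyAi y - deriv airyAi x * airyAi y) / (x - y)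

end

end WignerEdge

namespace WignerEdge

/-- Evaluation of the probabilists' Hermite polynomial. -/
noncomputable def hermiteEval {F : Type*} [Field F] (n : ℕ) (x : F) : F :=
  Polynomial.aeval x (Polynomial.hermite n)

theorem derivative_hermite_succ (n : ℕ) :
    Polynomial.derivative (Polynomial.hermite (n + 1)) =
      ((n : Polynomial ℤ) + 1) * Polynomial.hermite n := by
  induction n with
  | zero => simp
  | succ n ih =>
    rw [Polynomial.hermite_succ (n + 1)]
    simp only [Polynomial.derivative_sub, Polynomial.derivative_mul, Polynomial.derivative_X, ih,
      Polynomial.derivative_add, Polynomial.derivative_natCast, Polynomial.derivative_one]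
    rw [Polynomial.hermite_succ n]
    push_cast
    ring

section Field

variable {F : Type*} [Field F]

@[simp] theorem hermiteEval_zero (x : F) : hermiteEval 0 x = 1 := by simp [hermiteEval]

@[simp] theorem hermiteEval_one (x : F) : hermiteEval 1 x = x := by simp [hermiteEval]

theorem hermiteEval_add_two (n : ℕ) (x : F) :
    hermiteEval (n + 2) x = x * hermiteEval (n + 1) x - (n + 1) * hermiteEval n x := by
  unfold hermiteEval
  rw [Polynomial.hermite_succ (n + 1), derivative_hermite_succ]
  simp

/-- The Christoffel–Darboux kernel of the Hermite polynomials. -/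
noncomputable def hermiteKernel (n : ℕ) (s t : F) : F :=
  ∑ k ∈ Finset.range (n + 1), hermiteEval k s * hermiteEval k t / (k.factorial : F)

theorem hermiteKernel_succ (n : ℕ) (s t : F) :
    hermiteKernel (n + 1) s t = hermiteKernel n s t +
      hermiteEval (n + 1) s * hermiteEval (n + 1) t / ((n + 1).factorial : F) := by
  unfold hermiteKernel
  rw [Finset.sum_range_succ]

/-- The antisymmetric combination of consecutive Hermite polynomials. -/
noncomputable def hermiteCross (n : ℕ) (s t : F) : F :=
  hermiteEval (n + 1) s * hermiteEval n t - hermiteEval n s * hermiteEval (n + 1) t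

variable [CharZero F]

theorem christoffel_darboux (n : ℕ) (s t : F) :
    (s - t) * (n.factorial * hermiteKernel n s t) = hermiteCross n s t := by
  induction n with
  | zero => simp [hermiteCross, hermiteKernel]
  | succ n ih =>
    have h : ((n + 1).factorial : F) ≠ 0 := by exact_mod_cast (n + 1).factorial_ne_zero
    rw [hermiteKernel_succ, mul_add ((n + 1).factorial : F), mul_div_cancel₀ _ h,
      Nat.factorial_succ]
    unfold hermiteCross at *
    rw [hermiteEval_add_two, hermiteEval_add_two]
    push_cast
    linear_combination ((n : F) + 1) * ih

theorem christoffel_darboux_diag (n : ℕ) (s : F) :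
    n.factorial * hermiteKernel n s s = (n + 1) * hermiteEval n s ^ 2 -
      s * hermiteEval n s * hermiteEval (n + 1) s + hermiteEval (n + 1) s ^ 2 := by
  induction n with
  | zero => simp [hermiteKernel]; ring
  | succ n ih =>
    have h : ((n + 1).factorial : F) ≠ 0 := by exact_mod_cast (n + 1).factorial_ne_zero
    rw [hermiteKernel_succ, mul_add ((n + 1).factorial : F), mul_div_cancel₀ _ h,
      Nat.factorial_succ, hermiteEval_add_two]
    push_cast
    linear_combination ((n : F) + 1) * ih

end Field

theorem hermiteEval_ofReal (n : ℕ) (x : ℝ) :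
    hermiteEval n (x : ℂ) = ((hermiteEval n x : ℝ) : ℂ) := by
  unfold hermiteEval
  exact (Polynomial.aeval_algebraMap_apply ℂ x (Polynomial.hermite n))

theorem hermiteKernel_ofReal (n : ℕ) (s t : ℝ) :
    hermiteKernel n (s : ℂ) (t : ℂ) = ((hermiteKernel n s t : ℝ) : ℂ) := by
  unfold hermiteKernel
  push_cast
  simp only [hermiteEval_ofReal]

theorem hasDerivAt_hermiteEval (n : ℕ) (z : ℂ) :
    HasDerivAt (hermiteEval n) (z * hermiteEval n z - hermiteEval (n + 1) z) z := by
  have h := Polynomial.hasDerivAt_aeval (Polynomial.hermite n) z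
  have e : z * hermiteEval n z - hermiteEval (n + 1) z =
      Polynomial.aeval z (Polynomial.derivative (Polynomial.hermite n)) := by
    unfold hermiteEval
    rw [Polynomial.hermite_succ]
    simp
  rw [e]
  exact h

theorem continuous_hermiteEval (n : ℕ) : Continuous (hermiteEval n : ℂ → ℂ) :=
  continuous_iff_continuousAt.2 fun z => (hasDerivAt_hermiteEval n z).continuousAt

theorem hermiteKernel_self_nonneg (n : ℕ) (s : ℝ) : 0 ≤ hermiteKernel n s s :=
  Finset.sum_nonneg fun _ _ => div_nonneg (mul_self_nonneg _) (Nat.cast_nonneg _)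

theorem hermiteKernel_self_mono {m n : ℕ} (h : m ≤ n) (s : ℝ) :
    hermiteKernel m s s ≤ hermiteKernel n s s :=
  Finset.sum_le_sum_of_subset_of_nonneg
    (Finset.range_mono (by omega)) fun _ _ _ => div_nonneg (mul_self_nonneg _) (Nat.cast_nonneg _)

theorem hermiteKernel_sq_le (n : ℕ) (s t : ℝ) :
    hermiteKernel n s t ^ 2 ≤ hermiteKernel n s s * hermiteKernel n t t := by
  have h := Finset.sum_mul_sq_le_sq_mul_sq (Finset.range (n + 1))
    (fun k => hermiteEval k s / √(k.factorial : ℝ)) (fun k => hermiteEval k t / √(k.factorial : ℝ))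
  have e : ∀ k : ℕ, √(k.factorial : ℝ) * √(k.factorial : ℝ) = k.factorial :=
    fun k => Real.mul_self_sqrt (Nat.cast_nonneg _)
  simpa only [hermiteKernel, div_mul_div_comm, e, div_pow, sq] using h

theorem one_add_abs_pow_mul_exp_le {c : ℝ} (hc : 0 < c) (n : ℕ) (y : ℝ) :
    (1 + |y|) ^ n * Real.exp (-c * y ^ 2) ≤
      (n.factorial * Real.exp (1 + 1 / (2 * c))) * Real.exp (-(c / 2) * y ^ 2) := by
  have h1 : (1 + |y|) ^ n ≤ n.factorial * Real.exp (1 + |y|) := by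
    have := Real.pow_div_factorial_le_exp (1 + |y|) (by positivity) n
    rw [div_le_iff₀ (by positivity)] at this
    linarith
  have h2 : |y| ≤ 1 / (2 * c) + c / 2 * y ^ 2 := by
    rw [← sq_abs]
    have : 1 / (2 * c) + c / 2 * |y| ^ 2 - |y| = (c * |y| - 1) ^ 2 / (2 * c) := by
      field_simp; ring
    have h3 : 0 ≤ (c * |y| - 1) ^ 2 / (2 * c) := by positivity
    linarith
  calc (1 + |y|) ^ n * Real.exp (-c * y ^ 2)
      ≤ (n.factorial * Real.exp (1 + |y|)) * Real.exp (-c * y ^ 2) := by gcongr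
    _ = n.factorial * Real.exp (1 + |y| + -c * y ^ 2) := by rw [Real.exp_add (1 + |y|)]; ring
    _ ≤ n.factorial * Real.exp (1 + 1 / (2 * c) + -(c / 2) * y ^ 2) := by
        gcongr ?_ * Real.exp ?_
        linarith
    _ = _ := by rw [Real.exp_add (1 + 1 / (2 * c))]; ring

theorem integrable_one_add_abs_pow_mul_exp {c : ℝ} (hc : 0 < c) (n : ℕ) :
    Integrable fun y : ℝ => (1 + |y|) ^ n * Real.exp (-c * y ^ 2) := by
  refine ((integrable_exp_neg_mul_sq (half_pos hc)).const_mul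
    (n.factorial * Real.exp (1 + 1 / (2 * c)))).mono'
    (Continuous.aestronglyMeasurable (by fun_prop)) (Eventually.of_forall fun y => ?_)
  rw [Real.norm_of_nonneg (by positivity)]
  exact one_add_abs_pow_mul_exp_le hc n y

theorem norm_add_mul_I_le (c y : ℝ) : ‖(c : ℂ) + y * Complex.I‖ ≤ (1 + |c|) * (1 + |y|) := by
  refine (norm_add_le _ _).trans ?_
  simp only [Complex.norm_real, norm_mul, Complex.norm_I, mul_one, Real.norm_eq_abs]
  nlinarith [abs_nonneg c, abs_nonneg y, mul_nonneg (abs_nonneg c) (abs_nonneg y)]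

/-- The integrand of the Fourier representation of Hermite polynomials. -/
noncomputable def hermiteIntegrand (c x : ℝ) (n : ℕ) (y : ℝ) : ℂ :=
  ((c : ℂ) + y * Complex.I) ^ n * Complex.exp (((c : ℂ) + y * Complex.I - x) ^ 2 / 2)

theorem norm_cexp_half_sq (c x y : ℝ) :
    ‖Complex.exp (((c : ℂ) + y * Complex.I - x) ^ 2 / 2)‖ =
      Real.exp ((c - x) ^ 2 / 2) * Real.exp (-(1 / 2) * y ^ 2) := by
  rw [Complex.norm_exp, ← Real.exp_add]
  congr 1
  have : ((c : ℂ) + y * Complex.I - x) ^ 2 / 2 =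
      (((c - x) ^ 2 / 2 - y ^ 2 / 2 : ℝ) : ℂ) + ((c - x) * y : ℝ) * Complex.I := by
    push_cast
    linear_combination (y : ℂ) ^ 2 / 2 * Complex.I_sq
  rw [this, Complex.add_re, Complex.ofReal_re, Complex.re_ofReal_mul]
  simp
  ring

theorem integrable_hermiteIntegrand (c x : ℝ) (n : ℕ) : Integrable (hermiteIntegrand c x n) := by
  refine ((integrable_one_add_abs_pow_mul_exp (c := 1 / 2) (by norm_num) n).const_mul
    ((1 + |c|) ^ n * Real.exp ((c - x) ^ 2 / 2))).mono'
    (Continuous.aestronglyMeasurable (by unfold hermiteIntegrand; fun_prop))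
    (Eventually.of_forall fun y => ?_)
  unfold hermiteIntegrand
  rw [norm_mul, norm_pow, norm_cexp_half_sq]
  calc _ ≤ ((1 + |c|) * (1 + |y|)) ^ n *
        (Real.exp ((c - x) ^ 2 / 2) * Real.exp (-(1 / 2) * y ^ 2)) := by
          gcongr
          exact norm_add_mul_I_le c y
    _ = _ := by rw [mul_pow]; ring

theorem hasDerivAt_hermiteIntegrand (c x : ℝ) (n : ℕ) (y : ℝ) :
    HasDerivAt (hermiteIntegrand c x n)
      (n * hermiteIntegrand c x (n - 1) y * Complex.I +
        (hermiteIntegrand c x (n + 1) y - x * hermiteIntegrand c x n y) * Complex.I) y := by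
  have h0 : HasDerivAt (fun y : ℝ => (c : ℂ) + y * Complex.I) Complex.I y := by
    simpa using ((Complex.ofRealCLM.hasDerivAt (x := y)).mul_const Complex.I).const_add (c : ℂ)
  have h1 := h0.pow n
  have h2 := (((h0.sub_const (x : ℂ)).pow 2).div_const 2).cexp
  refine (h1.mul h2).congr_deriv ?_
  unfold hermiteIntegrand
  simp only [Pi.pow_apply, Nat.cast_ofNat, pow_succ]
  ring

theorem integral_hermiteIntegrand_succ (c x : ℝ) (n : ℕ) :
    ∫ y, hermiteIntegrand c x (n + 1) y =
      x * (∫ y, hermiteIntegrand c x n y) - n * ∫ y, hermiteIntegrand c x (n - 1) y := by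
  have hi := integrable_hermiteIntegrand c x
  have h1 := (hi (n - 1)).const_mul (n : ℂ)
  have h2 : Integrable fun y => hermiteIntegrand c x (n + 1) y - x * hermiteIntegrand c x n y :=
    (hi (n + 1)).sub ((hi n).const_mul (x : ℂ))
  have h := integral_eq_zero_of_hasDerivAt_of_integrable (hasDerivAt_hermiteIntegrand c x n)
    ((h1.mul_const Complex.I).add (h2.mul_const Complex.I)) (hi n)
  rw [integral_add (h1.mul_const _) (h2.mul_const _), integral_mul_const, integral_mul_const,
    integral_const_mul] at h
  rw [integral_sub (hi (n + 1)) ((hi n).const_mul _), integral_const_mul, ← add_mul,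
    mul_eq_zero, or_iff_left Complex.I_ne_zero] at h
  linear_combination h

theorem integral_hermiteIntegrand_zero (c x : ℝ) :
    ∫ y, hermiteIntegrand c x 0 y = √(2 * Real.pi) := by
  have h := GaussianFourier.integral_cexp_neg_mul_sq_add_real_mul_I (b := 1 / 2) (by norm_num)
    (x - c)
  have e : ∀ y : ℝ, hermiteIntegrand c x 0 y =
      Complex.exp (-(1 / 2 : ℂ) * (y + ((x - c : ℝ) : ℂ) * Complex.I) ^ 2) := by
    intro y
    unfold hermiteIntegrand
    rw [pow_zero, one_mul]
    congr 1
    push_cast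
    linear_combination ((y : ℂ) ^ 2 / 2 + (x - c) ^ 2 / 2) * Complex.I_sq
  simp_rw [e]
  rw [h, Real.sqrt_eq_rpow, Complex.ofReal_cpow (by positivity)]
  congr 1
  · push_cast; ring
  · push_cast; ring

theorem integral_hermiteIntegrand (c x : ℝ) (n : ℕ) :
    ∫ y, hermiteIntegrand c x n y = √(2 * Real.pi) * hermiteEval n (x : ℂ) := by
  induction n using Nat.strong_induction_on with
  | _ n ih =>
    match n with
    | 0 => rw [integral_hermiteIntegrand_zero]; simp
    | 1 => rw [integral_hermiteIntegrand_succ, integral_hermiteIntegrand_zero]; simp; ring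
    | n + 2 =>
      rw [integral_hermiteIntegrand_succ, ih (n + 1) (by omega), Nat.add_sub_cancel,
        ih n (by omega), hermiteEval_add_two]
      push_cast
      ring

/-- The integrand defining the Airy function. -/
noncomputable def airyIntegrand (x t : ℝ) : ℂ :=
  Complex.exp ((1 + (t : ℂ) * Complex.I) ^ 3 / 3 - (x : ℂ) * (1 + (t : ℂ) * Complex.I))

theorem norm_airyIntegrand (x t : ℝ) :
    ‖airyIntegrand x t‖ = Real.exp (1 / 3 - x) * Real.exp (-1 * t ^ 2) := by
  unfold airyIntegrand
  rw [Complex.norm_exp, ← Real.exp_add]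
  congr 1
  have : (1 + (t : ℂ) * Complex.I) ^ 3 / 3 - (x : ℂ) * (1 + (t : ℂ) * Complex.I) =
      ((1 / 3 - x - t ^ 2 : ℝ) : ℂ) + (t - x * t - t ^ 3 / 3 : ℝ) * Complex.I := by
    push_cast
    linear_combination ((t : ℂ) ^ 2 + t ^ 3 / 3 * Complex.I) * Complex.I_sq
  rw [this, Complex.add_re, Complex.ofReal_re, Complex.re_ofReal_mul]
  simp
  ring

/-- The integrals `∫ u ^ j exp (u ^ 3 / 3 - x u)` along the line `Re u = 1`. -/
noncomputable def airyMoment (j : ℕ) (x : ℝ) : ℂ :=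
  ∫ t : ℝ, (1 + (t : ℂ) * Complex.I) ^ j * airyIntegrand x t

theorem norm_one_add_mul_I_le (t : ℝ) : ‖1 + (t : ℂ) * Complex.I‖ ≤ 1 + |t| := by
  refine (norm_add_le _ _).trans ?_
  simp

theorem norm_pow_mul_airyIntegrand_le (j : ℕ) (x t : ℝ) :
    ‖(1 + (t : ℂ) * Complex.I) ^ j * airyIntegrand x t‖ ≤
      Real.exp (1 / 3 - x) * ((1 + |t|) ^ j * Real.exp (-1 * t ^ 2)) := by
  rw [norm_mul, norm_pow, norm_airyIntegrand]
  calc _ ≤ (1 + |t|) ^ j * (Real.exp (1 / 3 - x) * Real.exp (-1 * t ^ 2)) := by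
        gcongr
        exact norm_one_add_mul_I_le t
    _ = _ := by ring

theorem continuous_airyIntegrand (x : ℝ) : Continuous (airyIntegrand x) := by
  unfold airyIntegrand; fun_prop

theorem integrable_pow_mul_airyIntegrand (j : ℕ) (x : ℝ) :
    Integrable fun t : ℝ => (1 + (t : ℂ) * Complex.I) ^ j * airyIntegrand x t :=
  ((integrable_one_add_abs_pow_mul_exp one_pos j).const_mul (Real.exp (1 / 3 - x))).mono'
    (((by fun_prop : Continuous fun t : ℝ => (1 + (t : ℂ) * Complex.I) ^ j).mul
      (continuous_airyIntegrand x)).aestronglyMeasurable)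
    (Eventually.of_forall fun t => norm_pow_mul_airyIntegrand_le j x t)

theorem hasDerivAt_airyMoment (j : ℕ) (x : ℝ) :
    HasDerivAt (airyMoment j) (-airyMoment (j + 1) x) x := by
  have h := hasDerivAt_integral_of_dominated_loc_of_deriv_le (μ := volume)
    (F := fun (x t : ℝ) => (1 + (t : ℂ) * Complex.I) ^ j * airyIntegrand x t)
    (F' := fun (x t : ℝ) => -((1 + (t : ℂ) * Complex.I) ^ (j + 1) * airyIntegrand x t))
    (bound := fun t => Real.exp (1 / 3 - (x - 1)) * ((1 + |t|) ^ (j + 1) * Real.exp (-1 * t ^ 2)))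
    (x₀ := x) (Metric.ball_mem_nhds x one_pos)
    (Eventually.of_forall fun y => (integrable_pow_mul_airyIntegrand j y).aestronglyMeasurable)
    (integrable_pow_mul_airyIntegrand j x)
    (integrable_pow_mul_airyIntegrand (j + 1) x).neg.aestronglyMeasurable
    (Eventually.of_forall fun t y hy => ?_)
    ((integrable_one_add_abs_pow_mul_exp one_pos (j + 1)).const_mul _)
    (Eventually.of_forall fun t y _ => ?_)
  · have h2 := h.2
    rw [integral_neg] at h2
    exact h2
  · rw [norm_neg]
    refine (norm_pow_mul_airyIntegrand_le (j + 1) y t).trans ?_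
    gcongr
    rw [Metric.mem_ball, Real.dist_eq, abs_lt] at hy
    linarith
  · have h1 : HasDerivAt (fun y : ℝ => (1 + (t : ℂ) * Complex.I) ^ 3 / 3 -
        (y : ℂ) * (1 + (t : ℂ) * Complex.I)) (-(1 + (t : ℂ) * Complex.I)) y := by
      simpa using ((Complex.ofRealCLM.hasDerivAt (x := y)).mul_const
        (1 + (t : ℂ) * Complex.I)).const_sub ((1 + (t : ℂ) * Complex.I) ^ 3 / 3)
    refine (h1.cexp.const_mul ((1 + (t : ℂ) * Complex.I) ^ j)).congr_deriv ?_
    unfold airyIntegrand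
    ring

theorem airyMoment_two (x : ℝ) : airyMoment 2 x = x * airyMoment 0 x := by
  have hi := integrable_pow_mul_airyIntegrand
  have hd : ∀ t : ℝ, HasDerivAt (airyIntegrand x)
      (((1 + (t : ℂ) * Complex.I) ^ 2 * airyIntegrand x t -
        x * ((1 + (t : ℂ) * Complex.I) ^ 0 * airyIntegrand x t)) * Complex.I) t := by
    intro t
    have h0 : HasDerivAt (fun y : ℝ => 1 + (y : ℂ) * Complex.I) Complex.I t := by
      simpa using ((Complex.ofRealCLM.hasDerivAt (x := t)).mul_const Complex.I).const_add (1 : ℂ)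
    refine (((h0.pow 3).div_const 3).sub (h0.const_mul (x : ℂ))).cexp.congr_deriv ?_
    unfold airyIntegrand
    simp only [Pi.pow_apply, Pi.sub_apply, Nat.cast_ofNat]
    ring
  have h := integral_eq_zero_of_hasDerivAt_of_integrable hd
    (((hi 2 x).sub ((hi 0 x).const_mul (x : ℂ))).mul_const Complex.I)
    (by simpa using hi 0 x)
  rw [integral_mul_const, mul_eq_zero, or_iff_left Complex.I_ne_zero,
    integral_sub (hi 2 x) ((hi 0 x).const_mul _), integral_const_mul, sub_eq_zero] at h
  exact h

theorem airyMoment_re (j : ℕ) (x : ℝ) : (((airyMoment j x).re : ℝ) : ℂ) = airyMoment j x := by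
  rw [← Complex.conj_eq_iff_re]
  unfold airyMoment
  rw [← integral_conj, ← integral_neg_eq_self]
  congr 1
  ext t
  have h1 : (starRingEnd ℂ) (1 + ((-t : ℝ) : ℂ) * Complex.I) = 1 + (t : ℂ) * Complex.I := by
    simp
  unfold airyIntegrand
  rw [map_mul, map_pow, ← Complex.exp_conj, map_sub, map_div₀, map_mul, map_pow, h1, map_ofNat,
    Complex.conj_ofReal]

theorem airyAi_eq (x : ℝ) : airyAi x = 1 / (2 * Real.pi) * (airyMoment 0 x).re := by
  simp [airyAi, airyMoment, airyIntegrand]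

theorem hasDerivAt_airyMoment_re (j : ℕ) (x : ℝ) :
    HasDerivAt (fun x => (airyMoment j x).re) (-(airyMoment (j + 1) x).re) x := by
  exact (Complex.reCLM.hasFDerivAt.comp_hasDerivAt x (hasDerivAt_airyMoment j x)).congr_deriv
    (by simp)

theorem deriv_airyAi (x : ℝ) :
    deriv airyAi x = -(1 / (2 * Real.pi) * (airyMoment 1 x).re) := by
  have h : airyAi = fun x => 1 / (2 * Real.pi) * (airyMoment 0 x).re := funext airyAi_eq
  rw [h, ((hasDerivAt_airyMoment_re 0 x).const_mul _).deriv]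
  ring

theorem hasDerivAt_airyAi (x : ℝ) : HasDerivAt airyAi (deriv airyAi x) x := by
  rw [deriv_airyAi]
  have h : airyAi = fun x => 1 / (2 * Real.pi) * (airyMoment 0 x).re := funext airyAi_eq
  rw [h]
  exact ((hasDerivAt_airyMoment_re 0 x).const_mul _).congr_deriv (by ring)

/-- The Airy equation `Ai'' = x Ai`. -/
theorem hasDerivAt_deriv_airyAi (x : ℝ) : HasDerivAt (deriv airyAi) (x * airyAi x) x := by
  have h : deriv airyAi = fun x => -(1 / (2 * Real.pi) * (airyMoment 1 x).re) :=
    funext deriv_airyAi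
  rw [h]
  refine ((hasDerivAt_airyMoment_re 1 x).const_mul _).neg.congr_deriv ?_
  rw [airyMoment_two, airyAi_eq, Complex.re_ofReal_mul]
  ring

theorem sub_eq_mul_integral_of_hasDerivAt {f f' : ℝ → ℝ} (hf : ∀ x, HasDerivAt f (f' x) x)
    (hf' : Continuous f') (x y : ℝ) :
    f x - f y = (x - y) * ∫ θ in (0 : ℝ)..1, f' (y + θ * (x - y)) := by
  have h : ∀ θ ∈ Set.uIcc (0 : ℝ) 1, HasDerivAt (fun θ : ℝ => f (y + θ * (x - y)))
      (f' (y + θ * (x - y)) * (x - y)) θ := by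
    intro θ _
    have h0 : HasDerivAt (fun θ : ℝ => y + θ * (x - y)) (x - y) θ := by
      simpa using ((hasDerivAt_id θ).mul_const (x - y)).const_add y
    exact (hf _).comp θ h0
  have := intervalIntegral.integral_eq_sub_of_hasDerivAt h
    (Continuous.intervalIntegrable (by fun_prop) _ _)
  rw [intervalIntegral.integral_mul_const] at this
  rw [mul_comm, this]
  simp

theorem continuous_airyKernel : Continuous fun p : ℝ × ℝ => airyKernel p.1 p.2 := by
  have hA : Continuous airyAi :=
    continuous_iff_continuousAt.2 fun x => (hasDerivAt_airyAi x).continuousAt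
  have hA' : Continuous (deriv airyAi) :=
    continuous_iff_continuousAt.2 fun x => (hasDerivAt_deriv_airyAi x).continuousAt
  have hA'' : Continuous fun x => x * airyAi x := continuous_id.mul hA
  have key : ∀ p : ℝ × ℝ, airyKernel p.1 p.2 =
      deriv airyAi p.1 * (∫ θ in (0 : ℝ)..1, deriv airyAi (p.2 + θ * (p.1 - p.2))) -
      airyAi p.1 * ∫ θ in (0 : ℝ)..1,
        (p.2 + θ * (p.1 - p.2)) * airyAi (p.2 + θ * (p.1 - p.2)) := by
    rintro ⟨x, y⟩
    unfold airyKernel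
    split_ifs with h
    · dsimp only at h ⊢
      subst h
      simp
      ring
    · dsimp only at h ⊢
      have h1 := sub_eq_mul_integral_of_hasDerivAt hasDerivAt_airyAi hA' x y
      have h2 := sub_eq_mul_integral_of_hasDerivAt hasDerivAt_deriv_airyAi hA'' x y
      rw [div_eq_iff (sub_ne_zero.2 h)]
      linear_combination (deriv airyAi x) * h1 - airyAi x * h2
  simp_rw [key]
  have c1 : Continuous fun p : ℝ × ℝ =>
      ∫ θ in (0 : ℝ)..1, deriv airyAi (p.2 + θ * (p.1 - p.2)) :=
    intervalIntegral.continuous_parametric_intervalIntegral_of_continuous' (by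
      unfold Function.uncurry; fun_prop) 0 1
  have c2 : Continuous fun p : ℝ × ℝ =>
      ∫ θ in (0 : ℝ)..1, (p.2 + θ * (p.1 - p.2)) * airyAi (p.2 + θ * (p.1 - p.2)) :=
    intervalIntegral.continuous_parametric_intervalIntegral_of_continuous' (by
      unfold Function.uncurry; fun_prop) 0 1
  fun_prop

/-- The length scale `N ^ (1 / 6)` governing the edge of the spectrum. -/
noncomputable def edgeScale (N : ℕ) : ℝ := (N : ℝ) ^ (1 / 6 : ℝ)

theorem edgeScale_pow_six (N : ℕ) : edgeScale N ^ 6 = N := by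
  unfold edgeScale
  rw [← Real.rpow_natCast, ← Real.rpow_mul (Nat.cast_nonneg N)]
  norm_num

theorem edgeScale_nonneg (N : ℕ) : 0 ≤ edgeScale N := Real.rpow_nonneg (Nat.cast_nonneg N) _

theorem edgeScale_pos {N : ℕ} (hN : 0 < N) : 0 < edgeScale N :=
  Real.rpow_pos_of_pos (Nat.cast_pos.2 hN) _

theorem one_le_edgeScale {N : ℕ} (hN : 0 < N) : 1 ≤ edgeScale N :=
  Real.one_le_rpow (by exact_mod_cast hN) (by norm_num)

theorem tendsto_edgeScale : Tendsto edgeScale atTop atTop :=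
  (tendsto_rpow_atTop (by norm_num)).comp tendsto_natCast_atTop_atTop

theorem sqrt_eq_edgeScale (N : ℕ) : √(N : ℝ) = edgeScale N ^ 3 := by
  rw [← edgeScale_pow_six N, show edgeScale N ^ 6 = (edgeScale N ^ 3) ^ 2 by ring,
    Real.sqrt_sq (pow_nonneg (edgeScale_nonneg N) 3)]

theorem rpow_third_eq_edgeScale (N : ℕ) : (N : ℝ) ^ (1 / 3 : ℝ) = edgeScale N ^ 2 := by
  unfold edgeScale
  rw [← Real.rpow_natCast, ← Real.rpow_mul (Nat.cast_nonneg N)]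
  norm_num

theorem rpow_neg_eq_edgeScale (N : ℕ) : (N : ℝ) ^ (-(1 / 6) : ℝ) = (edgeScale N)⁻¹ :=
  Real.rpow_neg (Nat.cast_nonneg N) _

/-- The edge point `2 √N + μ N ^ (-1 / 6)`. -/
noncomputable def edgePoint (N : ℕ) (μ : ℝ) : ℝ := 2 * edgeScale N ^ 3 + μ * (edgeScale N)⁻¹

/-- The rescaled integrand of the Hermite polynomial of degree `N` at the edge. -/
noncomputable def edgeIntegrand (N : ℕ) (μ t : ℝ) : ℂ :=
  (1 + (1 + (t : ℂ) * Complex.I) / edgeScale N ^ 2) ^ N *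
    Complex.exp (edgeScale N ^ 2 * (1 + (t : ℂ) * Complex.I) ^ 2 / 2 -
      edgeScale N ^ 4 * (1 + (t : ℂ) * Complex.I) - μ * (1 + (t : ℂ) * Complex.I))

/-- The leading order of the Hermite polynomial of degree `N` at the edge. -/
noncomputable def edgeAmplitude (N : ℕ) (μ : ℝ) : ℝ :=
  edgeScale N ^ (3 * N + 1) * Real.exp (N / 2 + edgeScale N ^ 2 * μ +
    μ ^ 2 / (2 * edgeScale N ^ 2)) / √(2 * Real.pi)

theorem sqrt_two_pi_ne_zero : ((√(2 * Real.pi) : ℝ) : ℂ) ≠ 0 := by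
  have : √(2 * Real.pi) ≠ 0 := by positivity
  exact_mod_cast this

theorem one_add_div_edgeScale_ne_zero (N : ℕ) (t : ℝ) :
    1 + (1 + (t : ℂ) * Complex.I) / (edgeScale N : ℂ) ^ 2 ≠ 0 := by
  intro h0
  have := congrArg Complex.re h0
  rw [← Complex.ofReal_pow, Complex.add_re, Complex.div_ofReal_re] at this
  simp at this
  have : 0 ≤ (edgeScale N ^ 2)⁻¹ := by positivity
  linarith

theorem hermiteEval_edgePoint_eq_integral {N : ℕ} (hN : 0 < N) (μ : ℝ) (n : ℕ) :
    hermiteEval n (edgePoint N μ : ℂ) * edgeScale N ^ (3 * N) =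
      edgeAmplitude N μ * ∫ t : ℝ, (edgeScale N ^ 3 + edgeScale N * (1 + t * Complex.I)) ^ n *
        (1 + (1 + (t : ℂ) * Complex.I) / edgeScale N ^ 2)⁻¹ ^ N * edgeIntegrand N μ t := by
  have hq := edgeScale_pos hN
  have hqc : (edgeScale N : ℂ) ≠ 0 := by exact_mod_cast hq.ne'
  have h := integral_hermiteIntegrand (edgeScale N ^ 3 + edgeScale N) (edgePoint N μ) n
  have h2 := Measure.integral_comp_mul_left (hermiteIntegrand (edgeScale N ^ 3 + edgeScale N)
    (edgePoint N μ) n) (edgeScale N)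
  rw [abs_of_pos (inv_pos.2 hq), h, Complex.real_smul] at h2
  have h3 : ∀ t : ℝ, hermiteIntegrand (edgeScale N ^ 3 + edgeScale N) (edgePoint N μ) n
      (edgeScale N * t) = Real.exp (N / 2 + edgeScale N ^ 2 * μ + μ ^ 2 / (2 * edgeScale N ^ 2)) *
      ((edgeScale N ^ 3 + edgeScale N * (1 + t * Complex.I)) ^ n *
        (1 + (1 + (t : ℂ) * Complex.I) / edgeScale N ^ 2)⁻¹ ^ N * edgeIntegrand N μ t) := by
    intro t
    have hne := one_add_div_edgeScale_ne_zero N t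
    unfold edgeIntegrand hermiteIntegrand
    generalize 1 + (1 + (t : ℂ) * Complex.I) / (edgeScale N : ℂ) ^ 2 = w at hne
    have hw : w⁻¹ ^ N * w ^ N = 1 := by rw [← mul_pow, inv_mul_cancel₀ hne, one_pow]
    rw [show ∀ a b c d e : ℂ, a * (b * c * (d * e)) = b * (a * e) * (c * d)
      from fun _ _ _ _ _ => by ring, hw, mul_one, Complex.ofReal_exp, ← Complex.exp_add]
    congr 2
    · push_cast; ring
    · rw [← edgeScale_pow_six N]
      unfold edgePoint
      push_cast
      field_simp
      ring
  simp_rw [h3] at h2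
  rw [integral_const_mul] at h2
  have h4 : hermiteEval n (edgePoint N μ : ℂ) = (edgeScale N : ℂ) / √(2 * Real.pi) *
      (((edgeScale N)⁻¹ : ℝ) * (√(2 * Real.pi) * hermiteEval n (edgePoint N μ : ℂ))) := by
    have := sqrt_two_pi_ne_zero
    rw [Complex.ofReal_inv]
    field_simp
  rw [h4, ← h2]
  unfold edgeAmplitude
  push_cast
  ring

theorem hermiteEval_sub_edgePoint {N : ℕ} (hN : 0 < N) (μ : ℝ) {j : ℕ} (hj : j ≤ N) :
    hermiteEval (N - j) (edgePoint N μ : ℂ) * edgeScale N ^ (3 * j) = edgeAmplitude N μ *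
      ∫ t : ℝ, (1 + (1 + (t : ℂ) * Complex.I) / edgeScale N ^ 2)⁻¹ ^ j * edgeIntegrand N μ t := by
  have hqc : (edgeScale N : ℂ) ≠ 0 := by exact_mod_cast (edgeScale_pos hN).ne'
  have h := hermiteEval_edgePoint_eq_integral hN μ (N - j)
  have e : ∀ t : ℝ, ((edgeScale N : ℂ) ^ 3 + edgeScale N * (1 + t * Complex.I)) ^ (N - j) *
        (1 + (1 + (t : ℂ) * Complex.I) / edgeScale N ^ 2)⁻¹ ^ N * edgeIntegrand N μ t =
      (edgeScale N : ℂ) ^ (3 * (N - j)) *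
      ((1 + (1 + (t : ℂ) * Complex.I) / edgeScale N ^ 2)⁻¹ ^ j * edgeIntegrand N μ t) := by
    intro t
    have hne := one_add_div_edgeScale_ne_zero N t
    have : (edgeScale N : ℂ) ^ 3 + edgeScale N * (1 + t * Complex.I) =
        edgeScale N ^ 3 * (1 + (1 + (t : ℂ) * Complex.I) / edgeScale N ^ 2) := by
      field_simp
    rw [this, mul_pow, ← pow_mul]
    generalize 1 + (1 + (t : ℂ) * Complex.I) / (edgeScale N : ℂ) ^ 2 = w at hne
    have h5 : w⁻¹ ^ N = w⁻¹ ^ (N - j) * w⁻¹ ^ j := by rw [← pow_add, Nat.sub_add_cancel hj]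
    have h6 : w ^ (N - j) * w⁻¹ ^ (N - j) = 1 := by
      rw [← mul_pow, mul_inv_cancel₀ hne, one_pow]
    rw [h5]
    linear_combination (edgeScale N : ℂ) ^ (3 * (N - j)) * w⁻¹ ^ j * edgeIntegrand N μ t * h6
  simp_rw [e] at h
  rw [integral_const_mul] at h
  have h7 : (edgeScale N : ℂ) ^ (3 * N) =
      edgeScale N ^ (3 * (N - j)) * edgeScale N ^ (3 * j) := by
    rw [← pow_add, ← mul_add, Nat.sub_add_cancel hj]
  rw [h7] at h
  refine mul_left_cancel₀ (pow_ne_zero (3 * (N - j)) hqc) ?_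
  linear_combination h

theorem continuous_edgeIntegrand (N : ℕ) (μ : ℝ) : Continuous (edgeIntegrand N μ) := by
  unfold edgeIntegrand; fun_prop

theorem one_add_le_exp_cubic {a : ℝ} (ha : 0 ≤ a) (ha1 : a ≤ 1) :
    1 + a ≤ Real.exp (a - a ^ 2 / 2 + a ^ 3 / 3) := by
  have hx : 0 ≤ a - a ^ 2 / 2 + a ^ 3 / 3 := by nlinarith [pow_nonneg ha 3]
  have h := Real.sum_le_exp_of_nonneg hx 4
  simp only [Finset.sum_range_succ, Finset.sum_range_zero, Nat.factorial] at h
  norm_num at h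
  refine le_trans ?_ h
  have hy : 0 ≤ a - a ^ 2 / 2 := by nlinarith
  have h3 : 0 ≤ a ^ 3 / 3 := by positivity
  have h4 : 0 ≤ a ^ 4 * (5 / 24 - a / 24 - a ^ 2 / 48) :=
    mul_nonneg (by positivity) (by nlinarith)
  have hc : (a - a ^ 2 / 2) ^ 3 ≤ (a - a ^ 2 / 2 + a ^ 3 / 3) ^ 3 :=
    pow_le_pow_left₀ hy (by linarith) 3
  nlinarith [sq_nonneg (a ^ 3 / 3)]

/-- The integrand at the edge is dominated by a Gaussian, uniformly in `N`. -/
theorem norm_edgeIntegrand_le {N : ℕ} (hN : 0 < N) (μ t : ℝ) :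
    ‖edgeIntegrand N μ t‖ ≤ Real.exp (1 / 3 - μ) * Real.exp (-(3 / 8) * t ^ 2) := by
  have hq1 := one_le_edgeScale hN
  have hq6 := edgeScale_pow_six N
  unfold edgeIntegrand
  set q := edgeScale N
  have hp1 : 1 ≤ q ^ 2 := one_le_pow₀ hq1
  have hq6' : (N : ℝ) = (q ^ 2) ^ 3 := by rw [← hq6]; ring
  rw [show (q : ℂ) ^ 4 = ((q ^ 2 : ℝ) : ℂ) ^ 2 by push_cast; ring,
    show (q : ℂ) ^ 2 = ((q ^ 2 : ℝ) : ℂ) by push_cast; ring]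
  generalize q ^ 2 = p at *
  have hp : 0 < p := by linarith
  refine le_of_sq_le_sq ?_ (by positivity)
  have hre : (p * (1 + (t : ℂ) * Complex.I) ^ 2 / 2 - p ^ 2 * (1 + (t : ℂ) * Complex.I) -
      μ * (1 + (t : ℂ) * Complex.I)).re = p * (1 - t ^ 2) / 2 - p ^ 2 - μ := by
    have : p * (1 + (t : ℂ) * Complex.I) ^ 2 / 2 - p ^ 2 * (1 + (t : ℂ) * Complex.I) -
      μ * (1 + (t : ℂ) * Complex.I) = ((p * (1 - t ^ 2) / 2 - p ^ 2 - μ : ℝ) : ℂ) +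
        ((p * t - p ^ 2 * t - μ * t : ℝ) : ℂ) * Complex.I := by
      push_cast
      linear_combination (p : ℂ) * t ^ 2 / 2 * Complex.I_sq
    rw [this, Complex.add_re, Complex.re_ofReal_mul, Complex.ofReal_re, Complex.I_re]
    ring
  have hw : ‖1 + (1 + (t : ℂ) * Complex.I) / (p : ℂ)‖ ^ 2 ≤
      Real.exp (2 * (p⁻¹ - p⁻¹ ^ 2 / 2 + p⁻¹ ^ 3 / 3) + t ^ 2 / (p + 1) ^ 2) := by
    have h1 : 1 + (1 + (t : ℂ) * Complex.I) / (p : ℂ) =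
        ((1 + p⁻¹ : ℝ) : ℂ) + (t / p : ℝ) * Complex.I := by
      push_cast
      ring
    rw [h1, Complex.sq_norm, Complex.normSq_add_mul_I]
    have h2 : (1 + p⁻¹) ^ 2 + (t / p) ^ 2 = (1 + p⁻¹) ^ 2 * (1 + t ^ 2 / (p + 1) ^ 2) := by
      field_simp
    have h3 := one_add_le_exp_cubic (inv_nonneg.2 hp.le) (inv_le_one_of_one_le₀ hp1)
    rw [h2, Real.exp_add, two_mul, Real.exp_add, ← sq]
    gcongr
    linarith [Real.add_one_le_exp (t ^ 2 / (p + 1) ^ 2)]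
  rw [norm_mul, norm_pow, Complex.norm_exp, hre, mul_pow, ← pow_mul, mul_comm N 2, pow_mul]
  calc _ ≤ (Real.exp (2 * (p⁻¹ - p⁻¹ ^ 2 / 2 + p⁻¹ ^ 3 / 3) + t ^ 2 / (p + 1) ^ 2)) ^ N *
        Real.exp (p * (1 - t ^ 2) / 2 - p ^ 2 - μ) ^ 2 := by gcongr
    _ = Real.exp (N * (2 * (p⁻¹ - p⁻¹ ^ 2 / 2 + p⁻¹ ^ 3 / 3) + t ^ 2 / (p + 1) ^ 2) +
        2 * (p * (1 - t ^ 2) / 2 - p ^ 2 - μ)) := by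
      rw [← Real.exp_nat_mul, ← Real.exp_nat_mul, ← Real.exp_add]
      norm_cast
    _ ≤ Real.exp (2 * (1 / 3 - μ + -(3 / 8) * t ^ 2)) := by
      rw [Real.exp_le_exp, hq6']
      have h5 : p ^ 3 * (2 * (p⁻¹ - p⁻¹ ^ 2 / 2 + p⁻¹ ^ 3 / 3) + t ^ 2 / (p + 1) ^ 2) +
          2 * (p * (1 - t ^ 2) / 2 - p ^ 2 - μ) - 2 * (1 / 3 - μ + -(3 / 8) * t ^ 2) =
          - (t ^ 2 * ((5 / 4 * p + 3 / 4) * (p - 1)) / (p + 1) ^ 2) := by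
        field_simp
        ring
      have h6 : 0 ≤ t ^ 2 * ((5 / 4 * p + 3 / 4) * (p - 1)) / (p + 1) ^ 2 := by
        have : 0 ≤ p - 1 := by linarith
        positivity
      linarith
    _ = _ := by
      rw [← Real.exp_add, ← Real.exp_nat_mul]
      norm_cast

theorem tendsto_edgeIntegrand (μ t : ℝ) :
    Tendsto (fun N => edgeIntegrand N μ t) atTop (𝓝 (airyIntegrand μ t)) := by
  set u : ℂ := 1 + (t : ℂ) * Complex.I with hu
  have hw0 : Tendsto (fun N => ‖u‖ / edgeScale N ^ 2) atTop (𝓝 0) :=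
    ((tendsto_pow_atTop two_ne_zero).comp tendsto_edgeScale).const_div_atTop ‖u‖
  have hbound : Tendsto (fun N => ‖u‖ ^ 3 * (‖u‖ / edgeScale N ^ 2) *
      (1 - ‖u‖ / edgeScale N ^ 2)⁻¹ / 4) atTop (𝓝 0) := by
    have h := ((hw0.const_mul (‖u‖ ^ 3)).mul
      ((hw0.const_sub 1).inv₀ (by norm_num))).div_const 4
    simpa using h
  have hlog : Tendsto (fun N : ℕ => (N : ℂ) * (Complex.log (1 + u / edgeScale N ^ 2) -
      Complex.logTaylor 4 (u / edgeScale N ^ 2))) atTop (𝓝 0) := by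
    refine squeeze_zero_norm' ?_ hbound
    filter_upwards [hw0.eventually (gt_mem_nhds one_pos), eventually_gt_atTop 0] with N h1 hN
    have hq := edgeScale_pos hN
    have hn : ‖u / (edgeScale N : ℂ) ^ 2‖ = ‖u‖ / edgeScale N ^ 2 := by
      rw [norm_div, norm_pow, Complex.norm_real, Real.norm_of_nonneg hq.le]
    have h2 := Complex.norm_log_sub_logTaylor_le 3 (z := u / edgeScale N ^ 2) (by rwa [hn])
    rw [norm_mul, Complex.norm_natCast]
    refine (mul_le_mul_of_nonneg_left h2 (Nat.cast_nonneg N)).trans_eq ?_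
    rw [hn, ← edgeScale_pow_six N]
    generalize (1 - ‖u‖ / edgeScale N ^ 2)⁻¹ = r
    simp only [div_pow]
    field_simp
    norm_num
    ring
  have hexp := (hlog.add_const (u ^ 3 / 3 - μ * u)).cexp
  rw [zero_add] at hexp
  refine hexp.congr' ?_
  filter_upwards [eventually_gt_atTop 0] with N hN
  have hqc : (edgeScale N : ℂ) ≠ 0 := by exact_mod_cast (edgeScale_pos hN).ne'
  have hN6 : (N : ℂ) = (edgeScale N : ℂ) ^ 6 := by exact_mod_cast (edgeScale_pow_six N).symm
  unfold edgeIntegrand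
  have hne := one_add_div_edgeScale_ne_zero N t
  rw [← hu] at hne ⊢
  have hpow : (1 + u / (edgeScale N : ℂ) ^ 2) ^ N =
      Complex.exp (N * Complex.log (1 + u / (edgeScale N : ℂ) ^ 2)) := by
    rw [Complex.exp_nat_mul, Complex.exp_log hne]
  rw [hpow, ← Complex.exp_add]
  congr 1
  rw [mul_sub]
  have : (N : ℂ) * Complex.logTaylor 4 (u / edgeScale N ^ 2) =
      edgeScale N ^ 4 * u - edgeScale N ^ 2 * u ^ 2 / 2 + u ^ 3 / 3 := by
    simp only [Complex.logTaylor, Finset.sum_range_succ, Finset.sum_range_zero, hN6]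
    field_simp
    norm_num
    ring
  rw [this]
  ring

/-- Integrals against the rescaled integrand converge to integrals against the Airy integrand. -/
theorem tendsto_integral_mul_edgeIntegrand {g : ℕ → ℝ → ℂ} {g' : ℝ → ℂ} (μ : ℝ)
    (hg : ∀ N, Continuous (g N)) (hb : ∀ N, 0 < N → ∀ t, ‖g N t‖ ≤ 1 + |t|)
    (hlim : ∀ t, Tendsto (fun N => g N t) atTop (𝓝 (g' t))) :
    Tendsto (fun N => ∫ t, g N t * edgeIntegrand N μ t) atTop
      (𝓝 (∫ t, g' t * airyIntegrand μ t)) := by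
  refine tendsto_integral_filter_of_dominated_convergence
    (fun t => Real.exp (1 / 3 - μ) * ((1 + |t|) ^ 1 * Real.exp (-(3 / 8) * t ^ 2)))
    (Eventually.of_forall fun N => ((hg N).mul
      (continuous_edgeIntegrand N μ)).aestronglyMeasurable) ?_
    ((integrable_one_add_abs_pow_mul_exp (by norm_num) 1).const_mul _)
    (Eventually.of_forall fun t => (hlim t).mul (tendsto_edgeIntegrand μ t))
  filter_upwards [eventually_gt_atTop 0] with N hN
  refine Eventually.of_forall fun t => ?_
  rw [norm_mul, pow_one]
  calc _ ≤ (1 + |t|) * (Real.exp (1 / 3 - μ) * Real.exp (-(3 / 8) * t ^ 2)) := by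
        gcongr
        · exact hb N hN t
        · exact norm_edgeIntegrand_le hN μ t
    _ = _ := by ring

/-- The rescaled moments `∫ u ^ j φ_N` of the integrand at the edge. -/
noncomputable def edgeMoment (j N : ℕ) (μ : ℝ) : ℂ :=
  ∫ t : ℝ, (1 + (t : ℂ) * Complex.I) ^ j * edgeIntegrand N μ t

theorem tendsto_edgeMoment {j : ℕ} (hj : j ≤ 1) (μ : ℝ) :
    Tendsto (fun N => edgeMoment j N μ) atTop (𝓝 (airyMoment j μ)) := by
  refine tendsto_integral_mul_edgeIntegrand μ (fun _ => by fun_prop) (fun N _ t => ?_)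
    fun _ => tendsto_const_nhds
  rw [norm_pow]
  interval_cases j
  · simp
  · simpa using norm_one_add_mul_I_le t

theorem hermiteEval_edgePoint {N : ℕ} (hN : 0 < N) (μ : ℝ) :
    hermiteEval N (edgePoint N μ : ℂ) = edgeAmplitude N μ * edgeMoment 0 N μ := by
  simpa [edgeMoment] using hermiteEval_sub_edgePoint hN μ (Nat.zero_le N)

theorem integrable_mul_edgeIntegrand {N : ℕ} (hN : 0 < N) (μ : ℝ) (j : ℕ) :
    Integrable fun t : ℝ => (1 + (t : ℂ) * Complex.I) ^ j * edgeIntegrand N μ t := by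
  refine ((integrable_one_add_abs_pow_mul_exp (c := 3 / 8) (by norm_num) j).const_mul
    (Real.exp (1 / 3 - μ))).mono'
    (((by fun_prop : Continuous fun t : ℝ => (1 + (t : ℂ) * Complex.I) ^ j).mul
      (continuous_edgeIntegrand N μ)).aestronglyMeasurable) (Eventually.of_forall fun t => ?_)
  rw [norm_mul, norm_pow]
  calc _ ≤ (1 + |t|) ^ j * (Real.exp (1 / 3 - μ) * Real.exp (-(3 / 8) * t ^ 2)) := by
        gcongr
        · exact norm_one_add_mul_I_le t
        · exact norm_edgeIntegrand_le hN μ t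
    _ = _ := by ring

theorem hermiteEval_succ_edgePoint {N : ℕ} (hN : 0 < N) (μ : ℝ) :
    hermiteEval (N + 1) (edgePoint N μ : ℂ) = edgeAmplitude N μ *
      (edgeScale N ^ 3 * edgeMoment 0 N μ + edgeScale N * edgeMoment 1 N μ) := by
  have hqc : (edgeScale N : ℂ) ≠ 0 := by exact_mod_cast (edgeScale_pos hN).ne'
  have h := hermiteEval_edgePoint_eq_integral hN μ (N + 1)
  have e : ∀ t : ℝ, ((edgeScale N : ℂ) ^ 3 + edgeScale N * (1 + t * Complex.I)) ^ (N + 1) *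
        (1 + (1 + (t : ℂ) * Complex.I) / edgeScale N ^ 2)⁻¹ ^ N * edgeIntegrand N μ t =
      (edgeScale N : ℂ) ^ (3 * N) *
      (edgeScale N ^ 3 * ((1 + (t : ℂ) * Complex.I) ^ 0 * edgeIntegrand N μ t) +
        edgeScale N * ((1 + (t : ℂ) * Complex.I) ^ 1 * edgeIntegrand N μ t)) := by
    intro t
    have hne := one_add_div_edgeScale_ne_zero N t
    have h1 : (edgeScale N : ℂ) ^ 3 + edgeScale N * (1 + t * Complex.I) =
        edgeScale N ^ 3 * (1 + (1 + (t : ℂ) * Complex.I) / edgeScale N ^ 2) := by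
      field_simp
    rw [pow_succ, h1, mul_pow, ← pow_mul]
    generalize hw : 1 + (1 + (t : ℂ) * Complex.I) / (edgeScale N : ℂ) ^ 2 = w at *
    have h6 : w ^ N * w⁻¹ ^ N = 1 := by rw [← mul_pow, mul_inv_cancel₀ hne, one_pow]
    linear_combination (edgeScale N : ℂ) ^ (3 * N) * (edgeScale N ^ 3 * w) *
      edgeIntegrand N μ t * h6 - (edgeScale N : ℂ) ^ (3 * N) * edgeIntegrand N μ t * h1
  simp_rw [e] at h
  rw [integral_const_mul, integral_add ((integrable_mul_edgeIntegrand hN μ 0).const_mul _)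
    ((integrable_mul_edgeIntegrand hN μ 1).const_mul _), integral_const_mul,
    integral_const_mul] at h
  refine mul_left_cancel₀ (pow_ne_zero (3 * N) hqc) ?_
  rw [mul_comm, h]
  unfold edgeMoment
  ring

/-- The normalization of the Hermite kernel at the edge. -/
noncomputable def edgeNorm (N : ℕ) (μ ν : ℝ) : ℝ :=
  √(2 * Real.pi) * edgeScale N * Real.exp (2 * N + (μ + ν) * edgeScale N ^ 2)

theorem edgeNorm_pos {N : ℕ} (hN : 0 < N) (μ ν : ℝ) : 0 < edgeNorm N μ ν := by
  have := edgeScale_pos hN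
  unfold edgeNorm
  positivity

theorem edgeNorm_sq (N : ℕ) (μ ν : ℝ) :
    edgeNorm N μ ν ^ 2 = edgeNorm N μ μ * edgeNorm N ν ν := by
  unfold edgeNorm
  rw [mul_pow, ← Real.exp_nat_mul, show ∀ a b c : ℝ, a * b * (a * c) = a ^ 2 * (b * c)
    from fun _ _ _ => by ring, ← Real.exp_add]
  congr 2
  push_cast
  ring

/-- The ratio between the squared amplitude of the Hermite polynomials and the normalization. -/
noncomputable def edgeRatio (N : ℕ) (μ ν : ℝ) : ℝ :=
  edgeScale N ^ 2 * edgeAmplitude N μ * edgeAmplitude N ν / (N.factorial * edgeNorm N μ ν)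

theorem tendsto_edgeRatio (μ ν : ℝ) :
    Tendsto (fun N => edgeRatio N μ ν) atTop (𝓝 (1 / (2 * Real.pi) ^ 2)) := by
  have hs := (Stirling.tendsto_stirlingSeq_sqrt_pi.inv₀
    (Real.sqrt_pos.2 Real.pi_pos).ne').div_const (√2 * (2 * Real.pi * √(2 * Real.pi)))
  have he : Tendsto (fun N => Real.exp ((μ ^ 2 + ν ^ 2) / 2 / edgeScale N ^ 2)) atTop (𝓝 1) := by
    have := (((tendsto_pow_atTop two_ne_zero).comp tendsto_edgeScale).const_div_atTop
      ((μ ^ 2 + ν ^ 2) / 2)).rexp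
    simpa using this
  have hlim := hs.mul he
  have hc : (√Real.pi)⁻¹ / (√2 * (2 * Real.pi * √(2 * Real.pi))) * 1 =
      1 / (2 * Real.pi) ^ 2 := by
    rw [Real.sqrt_mul zero_le_two]
    have h1 : √Real.pi * √Real.pi = Real.pi := Real.mul_self_sqrt Real.pi_pos.le
    have h2 : √(2 : ℝ) * √2 = 2 := Real.mul_self_sqrt zero_le_two
    have h3 : (√Real.pi)⁻¹ / (√2 * (2 * Real.pi * (√2 * √Real.pi))) * 1 =
      1 / ((√2 * √2) * (√Real.pi * √Real.pi) * (2 * Real.pi)) := by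
      field_simp
    rw [h3, h1, h2]
    ring
  rw [hc] at hlim
  refine hlim.congr' ?_
  filter_upwards [eventually_gt_atTop 0] with N hN
  have hq := edgeScale_pos hN
  have hsq : √(2 * (N : ℝ)) = √2 * edgeScale N ^ 3 := by
    rw [Real.sqrt_mul zero_le_two, sqrt_eq_edgeScale]
  have hNN : (N : ℝ) ^ N = edgeScale N ^ (6 * N) := by rw [pow_mul, edgeScale_pow_six]
  unfold edgeRatio edgeNorm edgeAmplitude Stirling.stirlingSeq
  have hE : Real.exp (N / 2 + edgeScale N ^ 2 * μ + μ ^ 2 / (2 * edgeScale N ^ 2)) *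
      Real.exp (N / 2 + edgeScale N ^ 2 * ν + ν ^ 2 / (2 * edgeScale N ^ 2)) * Real.exp 1 ^ N =
      Real.exp ((μ ^ 2 + ν ^ 2) / 2 / edgeScale N ^ 2) *
        Real.exp (2 * N + (μ + ν) * edgeScale N ^ 2) := by
    rw [← Real.exp_nat_mul, ← Real.exp_add, ← Real.exp_add, ← Real.exp_add]
    congr 1
    field_simp
    ring
  rw [hsq, div_pow, hNN]
  have h2 : √(2 * Real.pi) ^ 2 = 2 * Real.pi := Real.sq_sqrt (by positivity)
  rw [show 6 * N = 3 * N + 3 * N by ring, pow_add, pow_succ]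
  have hR : 0 < √(2 * Real.pi) := by positivity
  have hE0 := Real.exp_pos (2 * N + (μ + ν) * edgeScale N ^ 2)
  have hX0 := Real.exp_pos (N / 2 + edgeScale N ^ 2 * μ + μ ^ 2 / (2 * edgeScale N ^ 2))
  generalize Real.exp ((μ ^ 2 + ν ^ 2) / 2 / edgeScale N ^ 2) = e1 at *
  generalize Real.exp (2 * N + (μ + ν) * edgeScale N ^ 2) = e2 at *
  generalize Real.exp (N / 2 + edgeScale N ^ 2 * μ + μ ^ 2 / (2 * edgeScale N ^ 2)) = X at *
  generalize Real.exp (N / 2 + edgeScale N ^ 2 * ν + ν ^ 2 / (2 * edgeScale N ^ 2)) = Y at *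
  have hY : Y = e1 * e2 / (X * Real.exp 1 ^ N) := by
    rw [eq_div_iff (by positivity)]
    linear_combination hE
  rw [hY]
  field_simp
  rw [h2]
  ring

theorem airyAi_ofReal (x : ℝ) : (airyAi x : ℂ) = airyMoment 0 x / (2 * Real.pi) := by
  rw [airyAi_eq, Complex.ofReal_mul, airyMoment_re]
  push_cast
  ring

theorem deriv_airyAi_ofReal (x : ℝ) :
    ((deriv airyAi x : ℝ) : ℂ) = -airyMoment 1 x / (2 * Real.pi) := by
  rw [deriv_airyAi, Complex.ofReal_neg, Complex.ofReal_mul, airyMoment_re]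
  push_cast
  ring

theorem tendsto_edgeScale_sq_inv :
    Tendsto (fun N => ((edgeScale N : ℂ) ^ 2)⁻¹) atTop (𝓝 0) := by
  have h := ((tendsto_pow_atTop two_ne_zero).comp tendsto_edgeScale).inv_tendsto_atTop
  have := (Complex.continuous_ofReal.tendsto 0).comp h
  simpa [Function.comp_def] using this

/-- The Christoffel–Darboux kernel of the Hermite polynomials converges to the Airy kernel at the
edge. -/
theorem tendsto_hermiteKernel_edgePoint_complex (μ ν : ℝ) :
    Tendsto (fun N => hermiteKernel N (edgePoint N μ : ℂ) (edgePoint N ν) / edgeNorm N μ ν) atTop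
      (𝓝 (airyKernel μ ν : ℂ)) := by
  have hr : Tendsto (fun N => (edgeRatio N μ ν : ℂ)) atTop (𝓝 (1 / (2 * Real.pi) ^ 2)) := by
    have := (Complex.continuous_ofReal.tendsto _).comp (tendsto_edgeRatio μ ν)
    simpa [Function.comp_def] using this
  have hpi : (Real.pi : ℂ) ≠ 0 := by exact_mod_cast Real.pi_ne_zero
  have h0 := fun x => tendsto_edgeMoment (Nat.zero_le 1) x
  have h1 := fun x => tendsto_edgeMoment le_rfl x
  have aux : ∀ {N : ℕ}, 0 < N → (edgeScale N : ℂ) ≠ 0 ∧ (edgeNorm N μ ν : ℂ) ≠ 0 ∧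
      (N.factorial : ℂ) ≠ 0 ∧ (N : ℂ) = (edgeScale N : ℂ) ^ 6 := fun {N} hN =>
    ⟨by exact_mod_cast (edgeScale_pos hN).ne', by exact_mod_cast (edgeNorm_pos hN μ ν).ne',
      by exact_mod_cast N.factorial_ne_zero, by exact_mod_cast (edgeScale_pow_six N).symm⟩
  by_cases hμν : μ = ν
  · subst hμν
    have hlim := hr.mul ((((h1 μ).pow 2).sub (((h0 μ).pow 2).const_mul (μ : ℂ))).add
      (tendsto_edgeScale_sq_inv.mul
        (((h0 μ).pow 2).sub (((h0 μ).mul (h1 μ)).const_mul (μ : ℂ)))))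
    have e : 1 / (2 * (Real.pi : ℂ)) ^ 2 * (airyMoment 1 μ ^ 2 - μ * airyMoment 0 μ ^ 2 +
        0 * (airyMoment 0 μ ^ 2 - μ * (airyMoment 0 μ * airyMoment 1 μ))) =
        (airyKernel μ μ : ℂ) := by
      rw [airyKernel, if_pos rfl]
      push_cast
      rw [airyAi_ofReal, deriv_airyAi_ofReal]
      ring
    rw [e] at hlim
    refine hlim.congr' ?_
    filter_upwards [eventually_gt_atTop 0] with N hN
    obtain ⟨hq, hn, hf, hN6⟩ := aux hN
    have hd := christoffel_darboux_diag N (edgePoint N μ : ℂ)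
    rw [hermiteEval_edgePoint hN, hermiteEval_succ_edgePoint hN] at hd
    rw [eq_div_iff hn, ← mul_right_inj' hf, hd, hN6]
    unfold edgeRatio edgePoint
    push_cast
    field_simp
    ring
  · have hne : (μ : ℂ) - ν ≠ 0 := sub_ne_zero.2 (by exact_mod_cast hμν)
    have hlim := hr.mul ((((h1 μ).mul (h0 ν)).sub ((h0 μ).mul (h1 ν))).div_const ((μ : ℂ) - ν))
    have e : 1 / (2 * (Real.pi : ℂ)) ^ 2 * ((airyMoment 1 μ * airyMoment 0 ν -
        airyMoment 0 μ * airyMoment 1 ν) / ((μ : ℂ) - ν)) = (airyKernel μ ν : ℂ) := by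
      rw [airyKernel, if_neg hμν]
      push_cast
      simp only [airyAi_ofReal, deriv_airyAi_ofReal]
      field_simp
      ring
    rw [e] at hlim
    refine hlim.congr' ?_
    filter_upwards [eventually_gt_atTop 0] with N hN
    obtain ⟨hq, hn, hf, hN6⟩ := aux hN
    have hd := christoffel_darboux N (edgePoint N μ : ℂ) (edgePoint N ν)
    unfold hermiteCross at hd
    rw [hermiteEval_edgePoint hN, hermiteEval_succ_edgePoint hN, hermiteEval_edgePoint hN,
      hermiteEval_succ_edgePoint hN] at hd
    have hst : (edgePoint N μ : ℂ) - edgePoint N ν = (μ - ν) / edgeScale N := by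
      unfold edgePoint
      push_cast
      ring
    rw [hst] at hd
    have hd' : hermiteKernel N (edgePoint N μ : ℂ) (edgePoint N ν) =
        edgeScale N ^ 2 * edgeAmplitude N μ * edgeAmplitude N ν / N.factorial *
        ((edgeMoment 1 N μ * edgeMoment 0 N ν - edgeMoment 0 N μ * edgeMoment 1 N ν) /
          ((μ : ℂ) - ν)) := by
      field_simp at hd ⊢
      linear_combination hd
    rw [hd']
    unfold edgeRatio
    push_cast
    field_simp

theorem tendsto_hermiteKernel_edgePoint (μ ν : ℝ) :
    Tendsto (fun N => hermiteKernel N (edgePoint N μ) (edgePoint N ν) / edgeNorm N μ ν) atTop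
      (𝓝 (airyKernel μ ν)) := by
  have h := (Complex.continuous_re.tendsto _).comp (tendsto_hermiteKernel_edgePoint_complex μ ν)
  refine h.congr fun N => ?_
  rw [Function.comp_apply, hermiteKernel_ofReal, ← Complex.ofReal_div, Complex.ofReal_re]

theorem tendsto_integral_inv_pow_mul_edgeIntegrand (j : ℕ) (μ : ℝ) :
    Tendsto (fun N => ∫ t : ℝ, (1 + (1 + (t : ℂ) * Complex.I) / edgeScale N ^ 2)⁻¹ ^ j *
      edgeIntegrand N μ t) atTop (𝓝 (airyMoment 0 μ)) := by
  unfold airyMoment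
  refine tendsto_integral_mul_edgeIntegrand μ (fun N => ?_) (fun N _ t => ?_) fun t => ?_
  · exact ((by fun_prop : Continuous fun t : ℝ =>
      1 + (1 + (t : ℂ) * Complex.I) / (edgeScale N : ℂ) ^ 2).inv₀
        (one_add_div_edgeScale_ne_zero N)).pow j
  · have h1 : 1 ≤ ‖1 + (1 + (t : ℂ) * Complex.I) / (edgeScale N : ℂ) ^ 2‖ := by
      refine le_trans ?_ (Complex.re_le_norm _)
      rw [← Complex.ofReal_pow, Complex.add_re, Complex.div_ofReal_re]
      simp
      positivity
    rw [norm_pow, norm_inv]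
    refine (pow_le_one₀ (by positivity) (inv_le_one_of_one_le₀ h1)).trans ?_
    linarith [abs_nonneg t]
  · have h := ((((tendsto_edgeScale_sq_inv.const_mul (1 + (t : ℂ) * Complex.I)).const_add
      1).inv₀ (by simp)).pow j)
    simpa [div_eq_mul_inv] using h

theorem tendsto_hermiteEval_mul_div_edgeNorm (j : ℕ) (μ ν : ℝ) :
    Tendsto (fun N => hermiteEval (N - j) (edgePoint N μ) * hermiteEval (N - j) (edgePoint N ν) /
      ((N - j).factorial : ℝ) / edgeNorm N μ ν) atTop (𝓝 0) := by
  set S : ℝ → ℕ → ℂ := fun μ N => ∫ t : ℝ,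
    (1 + (1 + (t : ℂ) * Complex.I) / edgeScale N ^ 2)⁻¹ ^ j * edgeIntegrand N μ t with hS
  have hSl : ∀ μ, Tendsto (S μ) atTop (𝓝 (airyMoment 0 μ)) :=
    tendsto_integral_inv_pow_mul_edgeIntegrand j
  have hb := ((tendsto_edgeRatio μ ν).mul (((hSl μ).norm.mul (hSl ν).norm))).mul
    ((tendsto_pow_atTop two_ne_zero).comp tendsto_edgeScale).inv_tendsto_atTop
  rw [mul_zero] at hb
  refine squeeze_zero_norm' ?_ hb
  filter_upwards [eventually_gt_atTop 0, eventually_ge_atTop j] with N hN hj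
  have hq := edgeScale_pos hN
  have hn := edgeNorm_pos hN μ ν
  have key : ∀ μ, |hermiteEval (N - j) (edgePoint N μ)| * edgeScale N ^ (3 * j) =
      edgeAmplitude N μ * ‖S μ N‖ := by
    intro μ
    have h := congrArg norm (hermiteEval_sub_edgePoint hN μ hj)
    rw [norm_mul, norm_mul, hermiteEval_ofReal, Complex.norm_real, Complex.norm_real, norm_pow,
      Complex.norm_real, Real.norm_eq_abs, Real.norm_of_nonneg hq.le, Real.norm_of_nonneg] at h
    · exact h
    · unfold edgeAmplitude; positivity
  have hfact : (N.factorial : ℝ) ≤ edgeScale N ^ (6 * j) * (N - j).factorial := by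
    rw [pow_mul, edgeScale_pow_six]
    have h1 := Nat.factorial_mul_descFactorial hj
    have h2 := Nat.descFactorial_le_pow N j
    have h3 : N.factorial ≤ N ^ j * (N - j).factorial := by
      rw [← h1, mul_comm]
      exact Nat.mul_le_mul_right _ h2
    exact_mod_cast h3
  have hA : ∀ μ, 0 ≤ edgeAmplitude N μ := fun μ => by unfold edgeAmplitude; positivity
  rw [norm_div, norm_div, norm_mul, Real.norm_eq_abs, Real.norm_eq_abs, Real.norm_of_nonneg hn.le,
    Real.norm_of_nonneg (Nat.cast_nonneg _)]
  have e1 : |hermiteEval (N - j) (edgePoint N μ)| * |hermiteEval (N - j) (edgePoint N ν)| /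
      ((N - j).factorial : ℝ) / edgeNorm N μ ν =
      (edgeAmplitude N μ * ‖S μ N‖) * (edgeAmplitude N ν * ‖S ν N‖) /
      (edgeScale N ^ (6 * j) * (N - j).factorial) / edgeNorm N μ ν := by
    rw [← key, ← key, show 6 * j = 3 * j + 3 * j by ring, pow_add]
    field_simp
  rw [e1]
  have e2 : edgeRatio N μ ν * (‖S μ N‖ * ‖S ν N‖) *
      (edgeScale N ^ 2)⁻¹ = (edgeAmplitude N μ * ‖S μ N‖) * (edgeAmplitude N ν * ‖S ν N‖) /
      N.factorial / edgeNorm N μ ν := by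
    unfold edgeRatio
    field_simp
  simp only [Function.comp_apply, Pi.inv_apply]
  rw [e2]
  have h1 := hA μ
  have h2 := hA ν
  gcongr

theorem tendsto_hermiteKernel_sub_edgePoint (j : ℕ) (μ ν : ℝ) :
    Tendsto (fun N => hermiteKernel (N - j) (edgePoint N μ) (edgePoint N ν) / edgeNorm N μ ν) atTop
      (𝓝 (airyKernel μ ν)) := by
  induction j with
  | zero => exact tendsto_hermiteKernel_edgePoint μ ν
  | succ j ih =>
    have h := ih.sub (tendsto_hermiteEval_mul_div_edgeNorm j μ ν)
    rw [sub_zero] at h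
    refine h.congr' ?_
    filter_upwards [eventually_gt_atTop j] with N hN
    obtain ⟨m, hm⟩ : ∃ m, N - j = m + 1 := ⟨N - j - 1, by omega⟩
    rw [show N - (j + 1) = m by omega, hm, hermiteKernel_succ]
    ring

/-- Smoothing the Hermite kernel over lower degrees with absolutely summable weights multiplies
the edge limit by the total weight. -/
theorem tendsto_sum_hermiteKernel_edgePoint (β μ ν : ℝ) :
    Tendsto (fun N : ℕ => (∑ k ∈ Finset.range (N / 2 + 1), β ^ k / k.factorial *
      hermiteKernel (N - 2 * k) (edgePoint N μ) (edgePoint N ν)) / edgeNorm N μ ν) atTop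
      (𝓝 (Real.exp β * airyKernel μ ν)) := by
  have hbd : ∃ M : ℝ, ∀ᶠ N in atTop, ∀ n ≤ N,
      |hermiteKernel n (edgePoint N μ) (edgePoint N ν) / edgeNorm N μ ν| ≤ M := by
    have h := (tendsto_hermiteKernel_edgePoint μ μ).mul (tendsto_hermiteKernel_edgePoint ν ν)
    refine ⟨√(airyKernel μ μ * airyKernel ν ν + 1), ?_⟩
    filter_upwards [h.eventually (gt_mem_nhds (lt_add_one _)), eventually_gt_atTop 0]
      with N hlt hN n hn
    refine Real.abs_le_sqrt (le_trans ?_ hlt.le)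
    rw [div_pow, edgeNorm_sq, div_mul_div_comm]
    have := edgeNorm_pos hN μ μ
    have := edgeNorm_pos hN ν ν
    gcongr
    refine (hermiteKernel_sq_le _ _ _).trans ?_
    exact mul_le_mul (hermiteKernel_self_mono hn _) (hermiteKernel_self_mono hn _)
      (hermiteKernel_self_nonneg _ _) (hermiteKernel_self_nonneg _ _)
  obtain ⟨M, hM⟩ := hbd
  have hsum : Summable fun k : ℕ => |β| ^ k / k.factorial * M :=
    (Real.summable_pow_div_factorial |β|).mul_right M
  have hexp : ∑' k : ℕ, β ^ k / k.factorial * airyKernel μ ν = Real.exp β * airyKernel μ ν := by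
    rw [tsum_mul_right, Real.exp_eq_exp_ℝ, NormedSpace.exp_eq_tsum_div]
  rw [← hexp]
  have hT := tendsto_tsum_of_dominated_convergence (𝓕 := atTop)
    (f := fun (N k : ℕ) => if k ∈ Finset.range (N / 2 + 1) then β ^ k / k.factorial *
      (hermiteKernel (N - 2 * k) (edgePoint N μ) (edgePoint N ν) / edgeNorm N μ ν) else 0)
    (g := fun k => β ^ k / k.factorial * airyKernel μ ν) hsum (fun k => ?_) ?_
  · refine hT.congr fun N => ?_
    rw [tsum_eq_sum (s := Finset.range (N / 2 + 1)) (fun k hk => if_neg hk), Finset.sum_div]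
    refine Finset.sum_congr rfl fun k hk => ?_
    rw [if_pos hk]
    ring
  · refine ((tendsto_hermiteKernel_sub_edgePoint (2 * k) μ ν).const_mul
      (β ^ k / k.factorial)).congr' ?_
    filter_upwards [eventually_ge_atTop (2 * k)] with N hN
    rw [if_pos (Finset.mem_range.2 (by omega))]
  · filter_upwards [hM] with N hN k
    have hM0 : 0 ≤ M := (abs_nonneg _).trans (hN 0 (Nat.zero_le _))
    split_ifs
    · rw [norm_mul, norm_div, norm_pow, Real.norm_eq_abs, Real.norm_natCast]
      gcongr
      exact hN _ (Nat.sub_le _ _)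
    · rw [norm_zero]
      positivity

section Determinants

variable {R : Type*} [CommRing R]

/-- Expansion of a determinant along its first row and first column. -/
theorem det_eq_sub_sum_adjugate {n : ℕ} (M : Matrix (Fin (n + 1)) (Fin (n + 1)) R) :
    M.det = M 0 0 * (M.submatrix Fin.succ Fin.succ).det -
      ∑ j, ∑ i, (M.submatrix Fin.succ Fin.succ).adjugate j i * (M 0 j.succ * M i.succ 0) := by
  rw [Matrix.det_succ_row_zero, Fin.sum_univ_succ, sub_eq_add_neg]
  congr 1
  · simp
  · rw [← Finset.sum_neg_distrib]
    refine Finset.sum_congr rfl fun j _ => ?_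
    match n, M, j with
    | n + 1, M, j =>
      rw [Matrix.det_succ_column_zero, Finset.mul_sum, ← Finset.sum_neg_distrib]
      refine Finset.sum_congr rfl fun i _ => ?_
      rw [Matrix.adjugate_fin_succ_eq_det_submatrix, Matrix.submatrix_submatrix,
        Matrix.submatrix_submatrix]
      have h : j.succ.succAbove ∘ Fin.succ = Fin.succ ∘ j.succAbove := by
        ext k; simp
      rw [h]
      simp only [Matrix.submatrix_apply, Fin.succ_succAbove_zero, Fin.val_succ]
      ring

theorem adjugate_diag_eq_det_submatrix {n : ℕ} (M : Matrix (Fin (n + 1)) (Fin (n + 1)) R)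
    (i : Fin (n + 1)) : M.adjugate i i = (M.submatrix i.succAbove i.succAbove).det := by
  rw [Matrix.adjugate_fin_succ_eq_det_submatrix, ← two_mul, pow_mul]
  simp

/-- The resolvent identity for adjugates. -/
theorem smul_adjugate_mul_adjugate {n : Type*} [Fintype n] [DecidableEq n] (M : Matrix n n R)
    (s t : R) :
    (t - s) • ((M - s • 1).adjugate * (M - t • 1).adjugate) =
      (M - s • (1 : Matrix n n R)).det • (M - t • 1).adjugate -
        (M - t • (1 : Matrix n n R)).det • (M - s • 1).adjugate := by
  have h : (t - s) • (1 : Matrix n n R) = (M - s • 1) - (M - t • 1) := by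
    rw [sub_smul]; abel
  calc _ = (M - s • 1).adjugate * ((t - s) • (1 : Matrix n n R)) * (M - t • 1).adjugate := by
        rw [Matrix.mul_smul, Matrix.mul_one, Matrix.smul_mul]
    _ = _ := by
        rw [h, Matrix.mul_sub, Matrix.sub_mul, Matrix.adjugate_mul, Matrix.mul_assoc,
          Matrix.mul_adjugate, Matrix.smul_mul, Matrix.one_mul, Matrix.mul_smul, Matrix.mul_one]

end Determinants

/-- Jacobi's formula for the derivative of the characteristic determinant. -/
theorem hasDerivAt_det_sub_smul_one {n : Type*} [Fintype n] [DecidableEq n] (M : Matrix n n ℂ)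
    (z : ℂ) :
    HasDerivAt (fun z => (M - z • (1 : Matrix n n ℂ)).det)
      (-(M - z • (1 : Matrix n n ℂ)).adjugate.trace) z := by
  simp_rw [Matrix.det_apply]
  have h1 : ∀ i j : n, HasDerivAt (fun z : ℂ => (M - z • (1 : Matrix n n ℂ)) i j)
      (-(1 : Matrix n n ℂ) i j) z := by
    intro i j
    simpa using ((hasDerivAt_id z).mul_const ((1 : Matrix n n ℂ) i j)).const_sub (M i j)
  refine (HasDerivAt.fun_sum (u := Finset.univ) fun σ _ =>
    ((HasDerivAt.fun_finsetProd (u := Finset.univ) fun i _ => h1 (σ i) i).const_smul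
      (Equiv.Perm.sign σ))).congr_deriv ?_
  rw [Matrix.trace]
  simp only [Finset.smul_sum, Matrix.diag_apply]
  rw [Finset.sum_comm, ← Finset.sum_neg_distrib]
  refine Finset.sum_congr rfl fun i _ => ?_
  rw [← Matrix.transpose_apply (Matrix.adjugate _), Matrix.adjugate_transpose,
    Matrix.adjugate_apply, Matrix.updateRow_transpose, Matrix.det_transpose, Matrix.det_apply,
    ← Finset.sum_neg_distrib]
  refine Finset.sum_congr rfl fun σ _ => ?_
  rw [← smul_neg]
  congr 1
  rw [← Finset.prod_erase_mul _ _ (Finset.mem_univ i), smul_eq_mul, mul_neg,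
    Matrix.updateCol_self, Pi.single_apply, Matrix.one_apply]
  congr 2
  refine Finset.prod_congr rfl fun j hj => ?_
  rw [Matrix.updateCol_ne (Finset.ne_of_mem_erase hj)]

section Matrices

variable {N : ℕ}

/-- The pair of row and column indices carried by a label. -/
def Index.pair (k : Index N) : Fin N × Fin N := Sum.elim Subtype.val Subtype.val k

/-- The part of the entry bound at position `(i, j)` that comes from the variable `k`. -/
noncomputable def entryFactor (x : Index N → ℝ) (i j : Fin N) (k : Index N) : ℝ :=
  if k.pair = (min i j, max i j) then 1 + |x k| else 1

theorem one_le_entryFactor (x : Index N → ℝ) (i j : Fin N) (k : Index N) :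
    1 ≤ entryFactor x i j k := by
  unfold entryFactor
  split_ifs
  · linarith [abs_nonneg (x k)]
  · exact le_rfl

/-- A bound for the entry at position `(i, j)`. -/
noncomputable def entryBound (x : Index N → ℝ) (i j : Fin N) : ℝ := ∏ k, entryFactor x i j k

theorem le_prod_of_one_le {ι : Type*} [Fintype ι] {f : ι → ℝ} (hf : ∀ i, 1 ≤ f i) (i : ι) :
    f i ≤ ∏ j, f j := by
  classical
  rw [← Finset.mul_prod_erase _ _ (Finset.mem_univ i)]
  exact le_mul_of_one_le_right (zero_le_one.trans (hf i))
    (Finset.one_le_prod fun j _ => hf j)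

theorem one_le_entryBound (x : Index N → ℝ) (i j : Fin N) : 1 ≤ entryBound x i j :=
  Finset.one_le_prod fun k _ => one_le_entryFactor x i j k

theorem add_abs_le_entryBound (x : Index N → ℝ) {i j : Fin N} (h : i < j) :
    |x (Sum.inl ⟨(i, j), h.le⟩)| + |x (Sum.inr ⟨(i, j), h⟩)| ≤ entryBound x i j := by
  unfold entryBound
  rw [Fintype.prod_sum_type]
  have h1 := le_prod_of_one_le (fun k => one_le_entryFactor x i j (Sum.inl k)) ⟨(i, j), h.le⟩
  have h2 := le_prod_of_one_le (fun k => one_le_entryFactor x i j (Sum.inr k)) ⟨(i, j), h⟩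
  have h3 := mul_le_mul h1 h2 (zero_le_one.trans (one_le_entryFactor x i j _))
    (zero_le_one.trans ((one_le_entryFactor x i j _).trans h1))
  refine le_trans ?_ h3
  simp only [entryFactor, Index.pair, Sum.elim_inl, Sum.elim_inr, min_eq_left h.le,
    max_eq_right h.le, if_true]
  nlinarith [abs_nonneg (x (Sum.inl ⟨(i, j), h.le⟩)), abs_nonneg (x (Sum.inr ⟨(i, j), h⟩)),
    mul_nonneg (abs_nonneg (x (Sum.inl ⟨(i, j), h.le⟩))) (abs_nonneg (x (Sum.inr ⟨(i, j), h⟩)))]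

theorem entryBound_comm (x : Index N → ℝ) (i j : Fin N) : entryBound x i j = entryBound x j i := by
  simp only [entryBound, entryFactor, min_comm i j, max_comm i j]

theorem norm_hermitianMatrix_le (x : Index N → ℝ) (i j : Fin N) :
    ‖hermitianMatrix x i j‖ ≤ 2 * entryBound x i j := by
  unfold hermitianMatrix
  rw [Matrix.of_apply]
  split_ifs with h1 h2
  · refine (norm_add_le _ _).trans ?_
    have := add_abs_le_entryBound x h1
    have := one_le_entryBound x i j
    simp only [norm_mul, Complex.norm_I, Complex.norm_real, Real.norm_eq_abs, one_mul]
    linarith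
  · refine (norm_sub_le _ _).trans ?_
    have := add_abs_le_entryBound x h2
    rw [entryBound_comm]
    have := one_le_entryBound x j i
    simp only [norm_mul, Complex.norm_I, Complex.norm_real, Real.norm_eq_abs, one_mul]
    linarith
  · obtain rfl : i = j := le_antisymm (not_lt.1 h2) (not_lt.1 h1)
    rw [norm_mul, Complex.norm_real, Complex.norm_real, Real.norm_of_nonneg (Real.sqrt_nonneg 2),
      Real.norm_eq_abs]
    have h3 := le_prod_of_one_le (one_le_entryFactor x i i) (Sum.inl ⟨(i, i), le_rfl⟩)
    have h4 : |x (Sum.inl ⟨(i, i), le_rfl⟩)| ≤ entryBound x i i := by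
      refine le_trans ?_ h3
      simp [entryFactor, Index.pair]
    have h5 : √2 ≤ 2 := by rw [Real.sqrt_le_left] <;> norm_num
    gcongr

/-- The product of `1 + |x k|` over all variables. -/
noncomputable def weight {ι : Type*} [Fintype ι] (x : ι → ℝ) : ℝ := ∏ k, (1 + |x k|)

theorem prod_entryBound_le (x : Index N → ℝ) (σ : Equiv.Perm (Fin N)) :
    ∏ i, entryBound x (σ i) i ≤ weight x ^ 2 := by
  unfold entryBound weight
  rw [Finset.prod_comm, ← Finset.prod_pow]
  refine Finset.prod_le_prod (fun k _ => Finset.prod_nonneg fun i _ =>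
    zero_le_one.trans (one_le_entryFactor x _ _ k)) fun k _ => ?_
  unfold entryFactor
  rw [Finset.prod_ite, Finset.prod_const, Finset.prod_const_one, mul_one]
  refine pow_le_pow_right₀ (by linarith [abs_nonneg (x k)]) ?_
  refine (Finset.card_le_card (t := {k.pair.1, k.pair.2}) fun i hi => ?_).trans
    Finset.card_le_two
  rw [Finset.mem_filter] at hi
  rw [Finset.mem_insert, Finset.mem_singleton, hi.2]
  dsimp only
  rcases le_total (σ i) i with h | h
  · right; rw [max_eq_right h]
  · left; rw [min_eq_right h]

/-- Every variable occurs at most twice in each term of a determinant. -/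
theorem norm_det_le_weight (x : Index N → ℝ) {M : Matrix (Fin N) (Fin N) ℂ} {C : ℝ} (hC : 0 ≤ C)
    (hM : ∀ i j, ‖M i j‖ ≤ C * entryBound x i j) :
    ‖M.det‖ ≤ N.factorial * C ^ N * weight x ^ 2 := by
  rw [Matrix.det_apply]
  refine (norm_sum_le _ _).trans ?_
  have : ∀ σ : Equiv.Perm (Fin N), ‖Equiv.Perm.sign σ • ∏ i, M (σ i) i‖ ≤
      C ^ N * weight x ^ 2 := by
    intro σ
    have h1 : ‖Equiv.Perm.sign σ • ∏ i, M (σ i) i‖ = ‖∏ i, M (σ i) i‖ := by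
      rcases Int.units_eq_one_or (Equiv.Perm.sign σ) with h | h <;> simp [h]
    rw [h1, norm_prod]
    calc _ ≤ ∏ i, C * entryBound x (σ i) i :=
          Finset.prod_le_prod (fun _ _ => norm_nonneg _) fun i _ => hM _ _
      _ = C ^ N * ∏ i, entryBound x (σ i) i := by
          rw [Finset.prod_mul_distrib, Finset.prod_const, Finset.card_univ, Fintype.card_fin]
      _ ≤ _ := by
          gcongr
          exact prod_entryBound_le x σ
  refine (Finset.sum_le_sum fun σ _ => this σ).trans_eq ?_
  rw [Finset.sum_const, Finset.card_univ, Fintype.card_perm, Fintype.card_fin, nsmul_eq_mul,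
    mul_assoc]

/-- The shifted Hermitian matrix. -/
noncomputable def shiftedMatrix (x : Index N → ℝ) (z : ℂ) : Matrix (Fin N) (Fin N) ℂ :=
  hermitianMatrix x - z • 1

theorem norm_shiftedMatrix_le (x : Index N → ℝ) (z : ℂ) (i j : Fin N) :
    ‖shiftedMatrix x z i j‖ ≤ (2 + ‖z‖) * entryBound x i j := by
  unfold shiftedMatrix
  rw [Matrix.sub_apply, Matrix.smul_apply, smul_eq_mul, add_mul]
  refine (norm_sub_le _ _).trans (add_le_add (norm_hermitianMatrix_le x i j) ?_)
  rw [norm_mul]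
  gcongr
  refine le_trans ?_ (one_le_entryBound x i j)
  rw [Matrix.one_apply]
  split_ifs <;> simp

theorem norm_det_shiftedMatrix_le (x : Index N → ℝ) (z : ℂ) :
    ‖(shiftedMatrix x z).det‖ ≤ N.factorial * (2 + ‖z‖) ^ N * weight x ^ 2 :=
  norm_det_le_weight x (by positivity) (norm_shiftedMatrix_le x z)

theorem norm_adjugate_shiftedMatrix_le (x : Index N → ℝ) (z : ℂ) (i j : Fin N) :
    ‖(shiftedMatrix x z).adjugate i j‖ ≤ N.factorial * (2 + ‖z‖) ^ N * weight x ^ 2 := by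
  rw [Matrix.adjugate_apply]
  refine norm_det_le_weight x (by positivity) fun k l => ?_
  rw [Matrix.updateRow_apply]
  split_ifs
  · have h1 : ‖(Pi.single i 1 : Fin N → ℂ) l‖ ≤ 1 := by
      rw [Pi.single_apply]
      split_ifs <;> simp
    have h2 := one_le_entryBound x k l
    nlinarith [norm_nonneg z]
  · exact norm_shiftedMatrix_le x z k l

theorem norm_trace_adjugate_shiftedMatrix_le (x : Index N → ℝ) (z : ℂ) :
    ‖(shiftedMatrix x z).adjugate.trace‖ ≤ N * (N.factorial * (2 + ‖z‖) ^ N) * weight x ^ 2 := by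
  rw [Matrix.trace]
  refine (norm_sum_le _ _).trans
    ((Finset.sum_le_sum fun i _ => norm_adjugate_shiftedMatrix_le x z i i).trans_eq ?_)
  rw [Finset.sum_const, Finset.card_univ, Fintype.card_fin, nsmul_eq_mul]
  ring

theorem continuous_hermitianMatrix : Continuous (hermitianMatrix (N := N)) := by
  refine continuous_matrix fun i j => ?_
  unfold hermitianMatrix
  simp only [Matrix.of_apply]
  split_ifs <;> fun_prop

theorem continuous_shiftedMatrix (z : ℂ) : Continuous fun x : Index N → ℝ => shiftedMatrix x z :=
  continuous_hermitianMatrix.sub continuous_const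

/-- The relabelling of variables induced by an order embedding of the matrix indices. -/
def Index.map {m n : ℕ} (f : Fin m ↪o Fin n) : Index m → Index n :=
  Sum.map (fun p => ⟨(f p.1.1, f p.1.2), f.le_iff_le.2 p.2⟩)
    (fun p => ⟨(f p.1.1, f p.1.2), f.lt_iff_lt.2 p.2⟩)

theorem Index.map_injective {m n : ℕ} (f : Fin m ↪o Fin n) :
    Function.Injective (Index.map f) := by
  refine Sum.map_injective.2 ⟨fun p q h => ?_, fun p q h => ?_⟩ <;>
  · simp only [Subtype.mk.injEq, Prod.mk.injEq, f.injective.eq_iff] at h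
    exact Subtype.ext (Prod.ext h.1 h.2)

theorem hermitianMatrix_comp_map {m n : ℕ} (f : Fin m ↪o Fin n) (x : Index n → ℝ) :
    hermitianMatrix (x ∘ Index.map f) = (hermitianMatrix x).submatrix f f := by
  ext i j
  simp only [hermitianMatrix, Matrix.of_apply, Matrix.submatrix_apply, f.lt_iff_lt]
  split_ifs <;> rfl

theorem shiftedMatrix_comp_map {m n : ℕ} (f : Fin m ↪o Fin n) (x : Index n → ℝ) (z : ℂ) :
    shiftedMatrix (x ∘ Index.map f) z = (shiftedMatrix x z).submatrix f f := by
  unfold shiftedMatrix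
  rw [hermitianMatrix_comp_map]
  ext i j
  simp [Matrix.one_apply, f.injective.eq_iff]

end Matrices

theorem integrable_one_add_abs_pow_four {Q : Measure ℝ} [IsFiniteMeasure Q]
    (hfin : Integrable (fun x : ℝ => x ^ 4) Q) : Integrable (fun x : ℝ => (1 + |x|) ^ 4) Q := by
  refine (((integrable_const (1 : ℝ)).add hfin).const_mul 8).mono'
    (Continuous.aestronglyMeasurable (by fun_prop)) (Eventually.of_forall fun x => ?_)
  rw [Real.norm_of_nonneg (by positivity)]
  have h := add_pow_le zero_le_one (abs_nonneg x) 4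
  rw [Even.pow_abs (by decide)] at h
  norm_num at h
  simpa using h

theorem integrable_weight_pow_four {ι : Type*} [Fintype ι] {Q : Measure ℝ} [IsFiniteMeasure Q]
    (hfin : Integrable (fun x : ℝ => x ^ 4) Q) :
    Integrable (fun x : ι → ℝ => weight x ^ 4) (Measure.pi fun _ => Q) := by
  simp only [weight, ← Finset.prod_pow]
  exact Integrable.fintype_prod (f := fun (_ : ι) (x : ℝ) => (1 + |x|) ^ 4)
    fun _ => integrable_one_add_abs_pow_four hfin

theorem integrable_of_norm_le_weight {ι : Type*} [Fintype ι] {Q : Measure ℝ} [IsFiniteMeasure Q]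
    (hfin : Integrable (fun x : ℝ => x ^ 4) Q) {f : (ι → ℝ) → ℂ} (hf : Continuous f) {C : ℝ}
    (hC : ∀ x, ‖f x‖ ≤ C * weight x ^ 4) : Integrable f (Measure.pi fun _ => Q) :=
  ((integrable_weight_pow_four hfin).const_mul C).mono' hf.aestronglyMeasurable
    (Eventually.of_forall hC)

theorem integrable_mul_of_norm_le_weight {ι : Type*} [Fintype ι] {Q : Measure ℝ}
    [IsFiniteMeasure Q] (hfin : Integrable (fun x : ℝ => x ^ 4) Q) {f g : (ι → ℝ) → ℂ}
    (hf : Continuous f) (hg : Continuous g) {C D : ℝ} (hC : ∀ x, ‖f x‖ ≤ C * weight x ^ 2)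
    (hD : ∀ x, ‖g x‖ ≤ D * weight x ^ 2) :
    Integrable (fun x => f x * g x) (Measure.pi fun _ => Q) := by
  refine integrable_of_norm_le_weight hfin (hf.mul hg) (C := C * D) fun x => ?_
  rw [norm_mul]
  refine (mul_le_mul (hC x) (hD x) (norm_nonneg _) ((norm_nonneg _).trans (hC x))).trans_eq ?_
  ring

/-- Selecting distinct coordinates of an i.i.d. family gives an i.i.d. family. -/
theorem measurePreserving_comp_injective {ι κ : Type*} [Fintype ι] [Fintype κ] (Q : Measure ℝ)
    [IsProbabilityMeasure Q] {g : κ → ι} (hg : Function.Injective g) :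
    MeasurePreserving (fun x : ι → ℝ => x ∘ g) (Measure.pi fun _ => Q)
      (Measure.pi fun _ => Q) := by
  refine ⟨by fun_prop, ?_⟩
  have h := (iIndepFun_pi (μ := fun _ : ι => Q) (X := fun _ => (id : ℝ → ℝ))
    fun _ => aemeasurable_id).precomp hg
  have h2 := h.map_fun_eq_pi_map fun k => (measurable_pi_apply (g k)).aemeasurable
  refine h2.trans ?_
  congr 1
  ext1 k
  exact (measurePreserving_eval (fun _ : ι => Q) (g k)).map_eq

section Moments

variable {X : Type*} [MeasurableSpace X] {ρ : Measure X} [IsProbabilityMeasure ρ] {ζ : X → ℂ}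

theorem integrable_pow_mul_conj_pow (hζ : Measurable ζ) (h4 : Integrable (fun x => ‖ζ x‖ ^ 4) ρ)
    {a b : ℕ} (ha : a ≤ 2) (hb : b ≤ 2) :
    Integrable (fun x => ζ x ^ a * (starRingEnd ℂ) (ζ x) ^ b) ρ := by
  refine ((integrable_const (1 : ℝ)).add h4).mono'
    ((hζ.pow_const a).mul ((Complex.continuous_conj.measurable.comp hζ).pow_const
      b)).aestronglyMeasurable (Eventually.of_forall fun x => ?_)
  rw [norm_mul, norm_pow, norm_pow, RCLike.norm_conj, ← pow_add]
  rcases le_total ‖ζ x‖ 1 with h | h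
  · refine (pow_le_one₀ (norm_nonneg _) h).trans ?_
    simp only [Pi.add_apply]
    have := pow_nonneg (norm_nonneg (ζ x)) 4
    linarith
  · refine (pow_le_pow_right₀ h (show a + b ≤ 4 by omega)).trans ?_
    simp

/-- The exponent with which the coordinate `m` occurs in a product of two coordinates. -/
def multiplicity₂ {ι : Type*} [DecidableEq ι] (j l m : ι) : ℕ :=
  (if j = m then 1 else 0) + if l = m then 1 else 0

theorem multiplicity₂_le {ι : Type*} [DecidableEq ι] (j l m : ι) : multiplicity₂ j l m ≤ 2 := by
  unfold multiplicity₂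
  split_ifs <;> omega

variable {ι : Type*} [Fintype ι] [DecidableEq ι]

theorem prod_pow_multiplicity₂ (v : ι → ℂ) (j l : ι) :
    ∏ m, v m ^ multiplicity₂ j l m = v j * v l := by
  simp only [multiplicity₂, pow_add, Finset.prod_mul_distrib]
  simp [pow_ite]

theorem mul_eq_prod_pow {Y : Type*} (w : ι → Y) (ζ : Y → ℂ) (j i l k : ι) :
    ζ (w j) * (starRingEnd ℂ) (ζ (w i)) * (ζ (w l) * (starRingEnd ℂ) (ζ (w k))) =
      ∏ m, ζ (w m) ^ multiplicity₂ j l m * (starRingEnd ℂ) (ζ (w m)) ^ multiplicity₂ i k m := by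
  rw [Finset.prod_mul_distrib, prod_pow_multiplicity₂ (fun m => ζ (w m)),
    prod_pow_multiplicity₂ (fun m => (starRingEnd ℂ) (ζ (w m)))]
  ring

theorem integrable_four_coordinates (hζ : Measurable ζ) (h4 : Integrable (fun x => ‖ζ x‖ ^ 4) ρ)
    (j i l k : ι) :
    Integrable (fun w : ι → X => ζ (w j) * (starRingEnd ℂ) (ζ (w i)) *
      (ζ (w l) * (starRingEnd ℂ) (ζ (w k)))) (Measure.pi fun _ => ρ) := by
  simp_rw [mul_eq_prod_pow]
  exact Integrable.fintype_prod (f := fun (m : ι) (x : X) => ζ x ^ multiplicity₂ j l m *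
    (starRingEnd ℂ) (ζ x) ^ multiplicity₂ i k m) fun m =>
    integrable_pow_mul_conj_pow hζ h4 (multiplicity₂_le _ _ _) (multiplicity₂_le _ _ _)

/-- Fourth-order moments of a vector of i.i.d. centred complex random variables with vanishing
pseudo-variance and unit variance. -/
theorem integral_four_coordinates {κ : ℂ} (h1 : ∫ x, ζ x ∂ρ = 0) (h2 : ∫ x, ζ x ^ 2 ∂ρ = 0)
    (h11 : ∫ x, ζ x * (starRingEnd ℂ) (ζ x) ∂ρ = 1)
    (h22 : ∫ x, ζ x ^ 2 * (starRingEnd ℂ) (ζ x) ^ 2 ∂ρ = κ) (j i l k : ι) :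
    ∫ w : ι → X, ζ (w j) * (starRingEnd ℂ) (ζ (w i)) * (ζ (w l) * (starRingEnd ℂ) (ζ (w k)))
      ∂(Measure.pi fun _ => ρ) =
    (if j = i then 1 else 0) * (if l = k then 1 else 0) +
      (if j = k then 1 else 0) * (if i = l then 1 else 0) +
      (κ - 2) * (if j = i ∧ i = l ∧ l = k then 1 else 0) := by
  simp_rw [mul_eq_prod_pow]
  rw [integral_fintype_prod_eq_prod (fun (m : ι) (x : X) => ζ x ^ multiplicity₂ j l m *
    (starRingEnd ℂ) (ζ x) ^ multiplicity₂ i k m)]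
  have hc1 : ∫ x, (starRingEnd ℂ) (ζ x) ∂ρ = 0 := by rw [integral_conj, h1, map_zero]
  have hc2 : ∫ x, (starRingEnd ℂ) (ζ x) ^ 2 ∂ρ = 0 := by
    simp_rw [← map_pow]
    rw [integral_conj, h2, map_zero]
  have h00 : ∫ x, ζ x ^ 0 * (starRingEnd ℂ) (ζ x) ^ 0 ∂ρ = 1 := by simp
  set f : ι → ℂ := fun m => ∫ x, ζ x ^ multiplicity₂ j l m *
    (starRingEnd ℂ) (ζ x) ^ multiplicity₂ i k m ∂ρ with hf
  have hfm : ∀ m a b, multiplicity₂ j l m = a → multiplicity₂ i k m = b →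
      f m = ∫ x, ζ x ^ a * (starRingEnd ℂ) (ζ x) ^ b ∂ρ := by
    rintro m _ _ rfl rfl
    rfl
  have f00 : ∀ m, multiplicity₂ j l m = 0 → multiplicity₂ i k m = 0 → f m = 1 :=
    fun m ha hb => (hfm m 0 0 ha hb).trans h00
  have f11 : ∀ m, multiplicity₂ j l m = 1 → multiplicity₂ i k m = 1 → f m = 1 :=
    fun m ha hb => (hfm m 1 1 ha hb).trans (by simpa using h11)
  have f10 : ∀ m, multiplicity₂ j l m = 1 → multiplicity₂ i k m = 0 → f m = 0 :=
    fun m ha hb => (hfm m 1 0 ha hb).trans (by simpa using h1)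
  have f01 : ∀ m, multiplicity₂ j l m = 0 → multiplicity₂ i k m = 1 → f m = 0 :=
    fun m ha hb => (hfm m 0 1 ha hb).trans (by simpa using hc1)
  have f02 : ∀ m, multiplicity₂ j l m = 0 → multiplicity₂ i k m = 2 → f m = 0 :=
    fun m ha hb => (hfm m 0 2 ha hb).trans (by simpa using hc2)
  have f22 : ∀ m, multiplicity₂ j l m = 2 → multiplicity₂ i k m = 2 → f m = κ :=
    fun m ha hb => (hfm m 2 2 ha hb).trans h22
  have zero : ∀ m, f m = 0 → ∏ m, f m = 0 := fun m h =>
    Finset.prod_eq_zero (Finset.mem_univ m) h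
  have one : (∀ m, multiplicity₂ j l m = multiplicity₂ i k m) → j ≠ l → ∏ m, f m = 1 := by
    intro h hjl
    refine Finset.prod_eq_one fun m _ => ?_
    have hle : multiplicity₂ j l m = 0 ∨ multiplicity₂ j l m = 1 := by
      unfold multiplicity₂
      split_ifs with h1 h2
      · exact absurd (h1.trans h2.symm) hjl
      all_goals simp
    rcases hle with h0 | h0
    · exact f00 m h0 (h m ▸ h0)
    · exact f11 m h0 (h m ▸ h0)
  clear_value f
  by_cases hjl : j = l
  · subst hjl
    by_cases hij : i = j
    · subst hij
      by_cases hk : k = i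
      · subst hk
        rw [Finset.prod_eq_single k (fun m _ hm => f00 m (by simp [multiplicity₂, hm.symm])
          (by simp [multiplicity₂, hm.symm])) (by simp)]
        rw [f22 k (by simp [multiplicity₂]) (by simp [multiplicity₂])]
        simp
        ring
      · rw [zero k (f01 k (by simp [multiplicity₂, Ne.symm hk])
          (by simp [multiplicity₂, Ne.symm hk]))]
        simp [Ne.symm hk]
    · have hji : j ≠ i := Ne.symm hij
      rw [zero i ?_]
      · simp [hij, hji]
      · by_cases hk : k = i
        · exact f02 i (by simp [multiplicity₂, hji]) (by simp [multiplicity₂, hk])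
        · exact f01 i (by simp [multiplicity₂, hji]) (by simp [multiplicity₂, hk])
  · have hlj : l ≠ j := Ne.symm hjl
    by_cases hij : i = j
    · subst hij
      by_cases hk : k = l
      · subst hk
        rw [one (fun _ => rfl) hjl]
        simp [hjl]
      · rw [zero l (f10 l (by simp [multiplicity₂, hjl]) (by simp [multiplicity₂, hjl, hk]))]
        simp [hjl, Ne.symm hk]
    · have hji : j ≠ i := Ne.symm hij
      by_cases hk : k = j
      · subst hk
        by_cases hil : i = l
        · subst hil
          rw [one (fun m => by unfold multiplicity₂; ring) hjl]
          simp [hji]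
        · rw [zero l (f10 l (by simp [multiplicity₂, hjl]) (by simp [multiplicity₂, hjl, hil]))]
          simp [hji, hil]
      · rw [zero j (f10 j (by simp [multiplicity₂, hlj]) (by simp [multiplicity₂, hij, hk]))]
        simp [hji, Ne.symm hk]

theorem integral_two_coordinates (h1 : ∫ x, ζ x ∂ρ = 0)
    (h11 : ∫ x, ζ x * (starRingEnd ℂ) (ζ x) ∂ρ = 1) (j i : ι) :
    ∫ w : ι → X, ζ (w j) * (starRingEnd ℂ) (ζ (w i)) ∂(Measure.pi fun _ => ρ) =
      if j = i then 1 else 0 := by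
  have hprod : ∀ w : ι → X, ζ (w j) * (starRingEnd ℂ) (ζ (w i)) =
      ∏ m, (if j = m then ζ (w m) else 1) * (if i = m then (starRingEnd ℂ) (ζ (w m)) else 1) := by
    intro w
    rw [Finset.prod_mul_distrib]
    simp
  simp_rw [hprod]
  rw [integral_fintype_prod_eq_prod (fun (m : ι) (x : X) => (if j = m then ζ x else 1) *
    (if i = m then (starRingEnd ℂ) (ζ x) else 1))]
  split_ifs with h
  · subst h
    refine Finset.prod_eq_one fun m _ => ?_
    split_ifs
    · exact h11
    · simp
  · refine Finset.prod_eq_zero (Finset.mem_univ j) ?_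
    simp [Ne.symm h, h1]

theorem integrable_two_coordinates (hζ : Measurable ζ) (h4 : Integrable (fun x => ‖ζ x‖ ^ 4) ρ)
    (j i : ι) : Integrable (fun w : ι → X => ζ (w j) * (starRingEnd ℂ) (ζ (w i)))
      (Measure.pi fun _ => ρ) := by
  have hprod : ∀ w : ι → X, ζ (w j) * (starRingEnd ℂ) (ζ (w i)) =
      ∏ m, ζ (w m) ^ (if j = m then 1 else 0) *
        (starRingEnd ℂ) (ζ (w m)) ^ (if i = m then 1 else 0) := by
    intro w
    rw [Finset.prod_mul_distrib]
    simp [pow_ite]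
  simp_rw [hprod]
  exact Integrable.fintype_prod (f := fun (m : ι) (x : X) => ζ x ^ (if j = m then 1 else 0) *
    (starRingEnd ℂ) (ζ x) ^ (if i = m then 1 else 0)) fun m =>
    integrable_pow_mul_conj_pow hζ h4 (by split_ifs <;> omega) (by split_ifs <;> omega)

end Moments

/-- The complex number with the given real and imaginary part. -/
noncomputable def toComplex (p : ℝ × ℝ) : ℂ := (p.1 : ℂ) + Complex.I * p.2

theorem continuous_toComplex : Continuous toComplex := by unfold toComplex; fun_prop

theorem conj_toComplex (p : ℝ × ℝ) :
    (starRingEnd ℂ) (toComplex p) = (p.1 : ℂ) - Complex.I * p.2 := by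
  unfold toComplex
  simp [sub_eq_add_neg]

section OneEntry

variable {Q : Measure ℝ} [IsProbabilityMeasure Q] {b : ℝ}

theorem integrable_ofReal_pow (hfin : Integrable (fun x : ℝ => x ^ 4) Q) {a : ℕ} (ha : a ≤ 4) :
    Integrable (fun x : ℝ => (x : ℂ) ^ a) Q := by
  refine (integrable_one_add_abs_pow_four hfin).mono'
    (Continuous.aestronglyMeasurable (by fun_prop)) (Eventually.of_forall fun x => ?_)
  rw [norm_pow, Complex.norm_real, Real.norm_eq_abs]
  calc |x| ^ a ≤ (1 + |x|) ^ a := by gcongr; linarith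
    _ ≤ (1 + |x|) ^ 4 := pow_le_pow_right₀ (by linarith [abs_nonneg x]) ha

theorem integrable_ofReal_pow_mul_pow (hfin : Integrable (fun x : ℝ => x ^ 4) Q) {a c : ℕ}
    (ha : a ≤ 4) (hc : c ≤ 4) :
    Integrable (fun p : ℝ × ℝ => (p.1 : ℂ) ^ a * (p.2 : ℂ) ^ c) (Q.prod Q) :=
  (integrable_ofReal_pow hfin ha).mul_prod (integrable_ofReal_pow hfin hc)

theorem integral_ofReal_pow_mul_pow (a c : ℕ) :
    ∫ p : ℝ × ℝ, (p.1 : ℂ) ^ a * (p.2 : ℂ) ^ c ∂(Q.prod Q) =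
      (∫ x, x ^ a ∂Q : ℝ) * (∫ x, x ^ c ∂Q : ℝ) := by
  rw [integral_prod_mul (fun x : ℝ => (x : ℂ) ^ a) (fun x : ℝ => (x : ℂ) ^ c),
    ← integral_complex_ofReal, ← integral_complex_ofReal]
  push_cast
  rfl

theorem integral_toComplex (hmean : ∫ x, x ∂Q = 0) (hfin : Integrable (fun x : ℝ => x ^ 4) Q) :
    ∫ p, toComplex p ∂(Q.prod Q) = 0 := by
  have e : ∀ p : ℝ × ℝ, toComplex p = (p.1 : ℂ) ^ 1 * (p.2 : ℂ) ^ 0 +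
      Complex.I * ((p.1 : ℂ) ^ 0 * (p.2 : ℂ) ^ 1) := fun p => by simp [toComplex]
  have hi := fun {a c : ℕ} => integrable_ofReal_pow_mul_pow (Q := Q) hfin (a := a) (c := c)
  simp_rw [e]
  rw [integral_add (hi (by norm_num) (by norm_num))
    ((hi (by norm_num) (by norm_num)).const_mul _), integral_const_mul,
    integral_ofReal_pow_mul_pow, integral_ofReal_pow_mul_pow]
  simp [hmean]

theorem integral_toComplex_sq (hmean : ∫ x, x ∂Q = 0)
    (hfin : Integrable (fun x : ℝ => x ^ 4) Q) :
    ∫ p, toComplex p ^ 2 ∂(Q.prod Q) = 0 := by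
  have e : ∀ p : ℝ × ℝ, toComplex p ^ 2 = ((p.1 : ℂ) ^ 2 * (p.2 : ℂ) ^ 0 -
      (p.1 : ℂ) ^ 0 * (p.2 : ℂ) ^ 2) +
      (2 * Complex.I) * ((p.1 : ℂ) ^ 1 * (p.2 : ℂ) ^ 1) := fun p => by
    unfold toComplex
    linear_combination (p.2 : ℂ) ^ 2 * Complex.I_sq
  have hi := fun {a c : ℕ} => integrable_ofReal_pow_mul_pow (Q := Q) hfin (a := a) (c := c)
  simp_rw [e]
  rw [integral_add ((hi (by norm_num) (by norm_num)).sub' (hi (by norm_num) (by norm_num)))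
    ((hi (by norm_num) (by norm_num)).const_mul _), integral_const_mul,
    integral_sub (hi (by norm_num) (by norm_num)) (hi (by norm_num) (by norm_num)),
    integral_ofReal_pow_mul_pow, integral_ofReal_pow_mul_pow, integral_ofReal_pow_mul_pow]
  simp [hmean]

theorem toComplex_mul_conj (p : ℝ × ℝ) :
    toComplex p * (starRingEnd ℂ) (toComplex p) = (p.1 : ℂ) ^ 2 + (p.2 : ℂ) ^ 2 := by
  rw [conj_toComplex]
  unfold toComplex
  linear_combination -(p.2 : ℂ) ^ 2 * Complex.I_sq

theorem integral_toComplex_mul_conj (hvar : ∫ x, x ^ 2 ∂Q = 1 / 2)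
    (hfin : Integrable (fun x : ℝ => x ^ 4) Q) :
    ∫ p, toComplex p * (starRingEnd ℂ) (toComplex p) ∂(Q.prod Q) = 1 := by
  have e : ∀ p : ℝ × ℝ, toComplex p * (starRingEnd ℂ) (toComplex p) =
      (p.1 : ℂ) ^ 2 * (p.2 : ℂ) ^ 0 + (p.1 : ℂ) ^ 0 * (p.2 : ℂ) ^ 2 := fun p => by
    rw [toComplex_mul_conj]
    ring
  have hi := fun {a c : ℕ} => integrable_ofReal_pow_mul_pow (Q := Q) hfin (a := a) (c := c)
  simp_rw [e]
  rw [integral_add (hi (by norm_num) (by norm_num)) (hi (by norm_num) (by norm_num)),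
    integral_ofReal_pow_mul_pow, integral_ofReal_pow_mul_pow, hvar]
  simp
  norm_num

theorem integral_toComplex_sq_mul_conj_sq (hvar : ∫ x, x ^ 2 ∂Q = 1 / 2)
    (hfin : Integrable (fun x : ℝ => x ^ 4) Q) (hb : ∫ x, x ^ 4 ∂Q = b) :
    ∫ p, toComplex p ^ 2 * (starRingEnd ℂ) (toComplex p) ^ 2 ∂(Q.prod Q) = 2 * b + 1 / 2 := by
  have e : ∀ p : ℝ × ℝ, toComplex p ^ 2 * (starRingEnd ℂ) (toComplex p) ^ 2 =
      ((p.1 : ℂ) ^ 4 * (p.2 : ℂ) ^ 0 + (p.1 : ℂ) ^ 0 * (p.2 : ℂ) ^ 4) +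
      2 * ((p.1 : ℂ) ^ 2 * (p.2 : ℂ) ^ 2) := fun p => by
    rw [← mul_pow, toComplex_mul_conj]
    ring
  have hi := fun {a c : ℕ} => integrable_ofReal_pow_mul_pow (Q := Q) hfin (a := a) (c := c)
  simp_rw [e]
  rw [integral_add ((hi (by norm_num) (by norm_num)).fun_add (hi (by norm_num) (by norm_num)))
    ((hi (by norm_num) (by norm_num)).const_mul _), integral_const_mul,
    integral_add (hi (by norm_num) (by norm_num)) (hi (by norm_num) (by norm_num)),
    integral_ofReal_pow_mul_pow, integral_ofReal_pow_mul_pow, integral_ofReal_pow_mul_pow, hvar, hb]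
  simp
  ring

theorem integrable_norm_toComplex_pow_four (hfin : Integrable (fun x : ℝ => x ^ 4) Q) :
    Integrable (fun p => ‖toComplex p‖ ^ 4) (Q.prod Q) := by
  have e : ∀ p : ℝ × ℝ, ‖toComplex p‖ ^ 4 = ‖((p.1 : ℂ) ^ 4 * (p.2 : ℂ) ^ 0 +
      (p.1 : ℂ) ^ 0 * (p.2 : ℂ) ^ 4) + 2 * ((p.1 : ℂ) ^ 2 * (p.2 : ℂ) ^ 2)‖ := fun p => by
    have : ((p.1 : ℂ) ^ 4 * (p.2 : ℂ) ^ 0 + (p.1 : ℂ) ^ 0 * (p.2 : ℂ) ^ 4) +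
        2 * ((p.1 : ℂ) ^ 2 * (p.2 : ℂ) ^ 2) =
        (toComplex p * (starRingEnd ℂ) (toComplex p)) ^ 2 := by
      rw [toComplex_mul_conj]
      ring
    rw [this, norm_pow, norm_mul, RCLike.norm_conj]
    ring
  have hi := fun {a c : ℕ} => integrable_ofReal_pow_mul_pow (Q := Q) hfin (a := a) (c := c)
  simp_rw [e]
  exact (((hi (by norm_num) (by norm_num)).fun_add (hi (by norm_num) (by norm_num))).add
    ((hi (by norm_num) (by norm_num)).const_mul _)).norm

end OneEntry

/-- The quadratic form of a matrix in a vector of complex entries. -/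
noncomputable def borderForm {N : ℕ} (A : Matrix (Fin N) (Fin N) ℂ) (w : Fin N → ℝ × ℝ) : ℂ :=
  ∑ j, ∑ i, A j i * (toComplex (w j) * (starRingEnd ℂ) (toComplex (w i)))

section Border

variable {Q : Measure ℝ} [IsProbabilityMeasure Q] {b : ℝ} {N : ℕ}

theorem integrable_borderForm (hfin : Integrable (fun x : ℝ => x ^ 4) Q)
    (A : Matrix (Fin N) (Fin N) ℂ) :
    Integrable (borderForm A) (Measure.pi fun _ => Q.prod Q) :=
  integrable_finsetSum _ fun j _ => integrable_finsetSum _ fun i _ =>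
    (integrable_two_coordinates continuous_toComplex.measurable
      (integrable_norm_toComplex_pow_four hfin) j i).const_mul _

theorem integral_borderForm (hmean : ∫ x, x ∂Q = 0) (hvar : ∫ x, x ^ 2 ∂Q = 1 / 2)
    (hfin : Integrable (fun x : ℝ => x ^ 4) Q) (A : Matrix (Fin N) (Fin N) ℂ) :
    ∫ w, borderForm A w ∂(Measure.pi fun _ => Q.prod Q) = A.trace := by
  have hi : ∀ j i : Fin N, Integrable (fun w : Fin N → ℝ × ℝ => A j i *
      (toComplex (w j) * (starRingEnd ℂ) (toComplex (w i)))) (Measure.pi fun _ => Q.prod Q) :=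
    fun j i => (integrable_two_coordinates continuous_toComplex.measurable
      (integrable_norm_toComplex_pow_four hfin) j i).const_mul _
  unfold borderForm
  rw [integral_finsetSum _ fun j _ => integrable_finsetSum _ fun i _ => hi j i]
  simp_rw [integral_finsetSum _ fun i _ => hi _ i, integral_const_mul,
    integral_two_coordinates (integral_toComplex hmean hfin)
      (integral_toComplex_mul_conj hvar hfin)]
  simp [Matrix.trace]

theorem borderForm_mul_borderForm (A B : Matrix (Fin N) (Fin N) ℂ) (w : Fin N → ℝ × ℝ) :
    borderForm A w * borderForm B w = ∑ j, ∑ i, ∑ l, ∑ k, A j i * B l k *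
      (toComplex (w j) * (starRingEnd ℂ) (toComplex (w i)) *
        (toComplex (w l) * (starRingEnd ℂ) (toComplex (w k)))) := by
  simp only [borderForm, Finset.sum_mul]
  refine Finset.sum_congr rfl fun j _ => Finset.sum_congr rfl fun i _ => ?_
  simp only [Finset.mul_sum]
  refine Finset.sum_congr rfl fun l _ => Finset.sum_congr rfl fun k _ => ?_
  ring

theorem integrable_borderForm_mul (hfin : Integrable (fun x : ℝ => x ^ 4) Q)
    (A B : Matrix (Fin N) (Fin N) ℂ) :
    Integrable (fun w => borderForm A w * borderForm B w) (Measure.pi fun _ => Q.prod Q) := by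
  simp_rw [borderForm_mul_borderForm]
  exact integrable_finsetSum _ fun j _ => integrable_finsetSum _ fun i _ =>
    integrable_finsetSum _ fun l _ => integrable_finsetSum _ fun k _ =>
    (integrable_four_coordinates continuous_toComplex.measurable
      (integrable_norm_toComplex_pow_four hfin) j i l k).const_mul _

theorem integral_borderForm_mul (hmean : ∫ x, x ∂Q = 0) (hvar : ∫ x, x ^ 2 ∂Q = 1 / 2)
    (hfin : Integrable (fun x : ℝ => x ^ 4) Q) (hb : ∫ x, x ^ 4 ∂Q = b)
    (A B : Matrix (Fin N) (Fin N) ℂ) :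
    ∫ w, borderForm A w * borderForm B w ∂(Measure.pi fun _ => Q.prod Q) =
      A.trace * B.trace + (A * B).trace + 2 * (b - 3 / 4) * ∑ i, A i i * B i i := by
  have hi : ∀ j i l k : Fin N, Integrable (fun w : Fin N → ℝ × ℝ => A j i * B l k *
      (toComplex (w j) * (starRingEnd ℂ) (toComplex (w i)) *
        (toComplex (w l) * (starRingEnd ℂ) (toComplex (w k))))) (Measure.pi fun _ => Q.prod Q) :=
    fun j i l k => (integrable_four_coordinates continuous_toComplex.measurable
      (integrable_norm_toComplex_pow_four hfin) j i l k).const_mul _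
  simp_rw [borderForm_mul_borderForm]
  rw [integral_finsetSum _ fun j _ => integrable_finsetSum _ fun i _ =>
    integrable_finsetSum _ fun l _ => integrable_finsetSum _ fun k _ => hi j i l k]
  simp_rw [integral_finsetSum _ fun i _ => integrable_finsetSum _ fun l _ =>
    integrable_finsetSum _ fun k _ => hi _ i l k,
    integral_finsetSum _ fun l _ => integrable_finsetSum _ fun k _ => hi _ _ l k,
    integral_finsetSum _ fun k _ => hi _ _ _ k, integral_const_mul,
    integral_four_coordinates (integral_toComplex hmean hfin) (integral_toComplex_sq hmean hfin)
      (integral_toComplex_mul_conj hvar hfin) (integral_toComplex_sq_mul_conj_sq hvar hfin hb),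
    mul_add, Finset.sum_add_distrib]
  congr 1
  · congr 1
    · simp [Matrix.trace, Finset.sum_mul_sum, mul_ite]
    · simp [Matrix.trace, Matrix.mul_apply]
  · rw [Finset.mul_sum]
    refine Finset.sum_congr rfl fun j _ => ?_
    rw [Finset.sum_eq_single j (fun i _ hij => by simp [Ne.symm hij]) (by simp),
      Finset.sum_eq_single j (fun l _ hl => by simp [Ne.symm hl]) (by simp),
      Finset.sum_eq_single j (fun k _ hk => by simp [Ne.symm hk]) (by simp)]
    simp
    ring

/-- The characteristic determinant of a bordered matrix. -/
noncomputable def borderDet (s a : ℂ) (A : Matrix (Fin N) (Fin N) ℂ)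
    (p : ℝ × (Fin N → ℝ × ℝ)) : ℂ :=
  ((√2 : ℝ) * (p.1 : ℂ) - s) * a - borderForm A p.2

/-- Averaging the product of two bordered determinants over the border. -/
theorem integral_borderDet_mul (hmean : ∫ x, x ∂Q = 0) (hvar : ∫ x, x ^ 2 ∂Q = 1 / 2)
    (hfin : Integrable (fun x : ℝ => x ^ 4) Q) (hb : ∫ x, x ^ 4 ∂Q = b) (s t a c : ℂ)
    (A B : Matrix (Fin N) (Fin N) ℂ) :
    ∫ p, borderDet s a A p * borderDet t c B p ∂(Q.prod (Measure.pi fun _ => Q.prod Q)) =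
      (1 + s * t) * (a * c) + s * (a * B.trace) + t * (c * A.trace) + A.trace * B.trace +
        (A * B).trace + 2 * (b - 3 / 4) * ∑ i, A i i * B i i := by
  have hx : ∀ k : ℕ, k ≤ 4 → Integrable (fun x : ℝ => (x : ℂ) ^ k) Q :=
    fun k hk => integrable_ofReal_pow hfin hk
  have hx1 : Integrable (fun x : ℝ => (x : ℂ)) Q := by simpa using hx 1 (by norm_num)
  have hlin : ∀ s a : ℂ, Integrable (fun x : ℝ => ((√2 : ℝ) * (x : ℂ) - s) * a) Q := fun s a =>
    ((hx1.const_mul _).sub' (integrable_const s)).mul_const a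
  have hm1 : ∫ x : ℝ, (x : ℂ) ∂Q = 0 := by rw [integral_complex_ofReal, hmean]; simp
  have hm2 : ∫ x : ℝ, (x : ℂ) ^ 2 ∂Q = 1 / 2 := by
    have : ∀ x : ℝ, (x : ℂ) ^ 2 = ((x ^ 2 : ℝ) : ℂ) := fun x => by push_cast; rfl
    simp_rw [this]
    rw [integral_complex_ofReal, hvar]
    simp
  have hElin : ∀ s a : ℂ, ∫ x : ℝ, ((√2 : ℝ) * (x : ℂ) - s) * a ∂Q = -s * a := fun s a => by
    rw [integral_mul_const, integral_sub (hx1.const_mul _) (integrable_const s),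
      integral_const_mul, hm1]
    simp
  have h2 : ((√2 : ℝ) : ℂ) ^ 2 = 2 := by
    rw [← Complex.ofReal_pow, Real.sq_sqrt zero_le_two]
    simp
  have eq2 : ∀ x : ℝ, ((√2 : ℝ) * (x : ℂ) - s) * a * (((√2 : ℝ) * (x : ℂ) - t) * c) =
      (2 * a * c) * (x : ℂ) ^ 2 + ((-(s + t) * a * c * (√2 : ℝ)) * (x : ℂ) + s * t * a * c) :=
    fun x => by linear_combination (x : ℂ) ^ 2 * a * c * h2
  have hquad : Integrable (fun x : ℝ => ((√2 : ℝ) * (x : ℂ) - s) * a *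
      (((√2 : ℝ) * (x : ℂ) - t) * c)) Q := by
    simp_rw [eq2]
    exact ((hx 2 (by norm_num)).const_mul _).fun_add ((hx1.const_mul _).fun_add
      (integrable_const _))
  have hEquad : ∫ x : ℝ, ((√2 : ℝ) * (x : ℂ) - s) * a * (((√2 : ℝ) * (x : ℂ) - t) * c) ∂Q =
      (1 + s * t) * (a * c) := by
    simp_rw [eq2]
    rw [integral_add ((hx 2 (by norm_num)).const_mul _)
      ((hx1.const_mul _).fun_add (integrable_const _)),
      integral_add (hx1.const_mul _) (integrable_const _), integral_const_mul,
      integral_const_mul, hm1, hm2]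
    simp
    ring
  set π' : Measure (Fin N → ℝ × ℝ) := Measure.pi fun _ => Q.prod Q with hπ
  have expand : ∀ p : ℝ × (Fin N → ℝ × ℝ), borderDet s a A p * borderDet t c B p =
      ((((√2 : ℝ) * (p.1 : ℂ) - s) * a * (((√2 : ℝ) * (p.1 : ℂ) - t) * c)) * 1 -
        (((√2 : ℝ) * (p.1 : ℂ) - s) * a) * borderForm B p.2) -
      ((((√2 : ℝ) * (p.1 : ℂ) - t) * c) * borderForm A p.2 -
        1 * (borderForm A p.2 * borderForm B p.2)) := fun p => by
    unfold borderDet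
    ring
  have i1 : Integrable (fun p : ℝ × (Fin N → ℝ × ℝ) => (((√2 : ℝ) * (p.1 : ℂ) - s) * a *
      (((√2 : ℝ) * (p.1 : ℂ) - t) * c)) * 1) (Q.prod π') :=
    hquad.mul_prod (integrable_const (1 : ℂ))
  have i2 : Integrable (fun p : ℝ × (Fin N → ℝ × ℝ) => (((√2 : ℝ) * (p.1 : ℂ) - s) * a) *
      borderForm B p.2) (Q.prod π') := (hlin s a).mul_prod (integrable_borderForm hfin B)
  have i3 : Integrable (fun p : ℝ × (Fin N → ℝ × ℝ) => (((√2 : ℝ) * (p.1 : ℂ) - t) * c) *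
      borderForm A p.2) (Q.prod π') := (hlin t c).mul_prod (integrable_borderForm hfin A)
  have i4 : Integrable (fun p : ℝ × (Fin N → ℝ × ℝ) => (1 : ℂ) *
      (borderForm A p.2 * borderForm B p.2)) (Q.prod π') :=
    (integrable_const (1 : ℂ)).mul_prod (integrable_borderForm_mul hfin A B)
  simp_rw [expand]
  rw [integral_sub (i1.sub' i2) (i3.sub' i4), integral_sub i1 i2, integral_sub i3 i4,
    integral_prod_mul (fun x : ℝ => ((√2 : ℝ) * (x : ℂ) - s) * a *
      (((√2 : ℝ) * (x : ℂ) - t) * c)) (fun _ : Fin N → ℝ × ℝ => (1 : ℂ)),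
    integral_prod_mul (fun x : ℝ => ((√2 : ℝ) * (x : ℂ) - s) * a) (borderForm B),
    integral_prod_mul (fun x : ℝ => ((√2 : ℝ) * (x : ℂ) - t) * c) (borderForm A),
    integral_prod_mul (fun _ : ℝ => (1 : ℂ))
      (fun w : Fin N → ℝ × ℝ => borderForm A w * borderForm B w),
    hEquad, hElin, hElin, integral_borderForm hmean hvar hfin, integral_borderForm hmean hvar hfin,
    integral_borderForm_mul hmean hvar hfin hb]
  simp
  ring

end Border

section Correlations

variable {N : ℕ}

/-- The variables of a matrix of size `N + 1` that lie in its first row. -/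
def borderIndex (N : ℕ) : Unit ⊕ (Fin N ⊕ Fin N) → Index (N + 1) :=
  Sum.elim (fun _ => Sum.inl ⟨(0, 0), le_rfl⟩)
    (Sum.elim (fun j => Sum.inl ⟨(0, j.succ), Fin.zero_le _⟩)
      (fun j => Sum.inr ⟨(0, j.succ), Fin.succ_pos j⟩))

theorem sumElim_borderIndex_injective (N : ℕ) : Function.Injective
    (Sum.elim (Index.map (Fin.succOrderEmb N)) (borderIndex N)) := by
  refine (Index.map_injective _).sumElim ?_ ?_
  · rintro (a | a | a) (c | c | c) h <;>
      simp_all [borderIndex]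
    all_goals exact absurd h.symm (Fin.succ_ne_zero _)
  · rintro (a | a) (c | c | c) h <;>
      simp_all [borderIndex, Index.map]

/-- Splitting off the first row of the matrix variables. -/
def splitBorder (x : Index (N + 1) → ℝ) : (Index N → ℝ) × (ℝ × (Fin N → ℝ × ℝ)) :=
  (x ∘ Index.map (Fin.succOrderEmb N), (x (Sum.inl ⟨(0, 0), le_rfl⟩),
    fun j => (x (Sum.inl ⟨(0, j.succ), Fin.zero_le _⟩), x (Sum.inr ⟨(0, j.succ), Fin.succ_pos j⟩))))

theorem measurePreserving_splitBorder (Q : Measure ℝ) [IsProbabilityMeasure Q] :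
    MeasurePreserving (splitBorder (N := N)) (Measure.pi fun _ => Q)
      ((Measure.pi fun _ => Q).prod (Q.prod (Measure.pi fun _ => Q.prod Q))) := by
  have h1 := measurePreserving_comp_injective Q (sumElim_borderIndex_injective N)
  have h2 := measurePreserving_sumPiEquivProdPi
    (fun _ : Index N ⊕ (Unit ⊕ (Fin N ⊕ Fin N)) => Q)
  have h3 := measurePreserving_sumPiEquivProdPi (fun _ : Unit ⊕ (Fin N ⊕ Fin N) => Q)
  have h4 := measurePreserving_sumPiEquivProdPi (fun _ : Fin N ⊕ Fin N => Q)
  have h5 := measurePreserving_piUnique (fun _ : Unit => Q)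
  have h6 := (measurePreserving_arrowProdEquivProdArrow ℝ ℝ (Fin N) (fun _ => Q)
    (fun _ => Q)).symm
  exact (((MeasurePreserving.id (Measure.pi fun _ : Index N => Q)).prod
    ((h5.prod (h6.comp h4)).comp h3)).comp h2).comp h1

theorem det_shiftedMatrix_succ (x : Index (N + 1) → ℝ) (s : ℂ) :
    (shiftedMatrix x s).det = borderDet s (shiftedMatrix (splitBorder x).1 s).det
      (shiftedMatrix (splitBorder x).1 s).adjugate (splitBorder x).2 := by
  have hsub : (shiftedMatrix x s).submatrix Fin.succ Fin.succ =
      shiftedMatrix (splitBorder x).1 s := (shiftedMatrix_comp_map (Fin.succOrderEmb N) x s).symm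
  rw [det_eq_sub_sum_adjugate, hsub]
  unfold borderDet borderForm
  congr 1
  · simp [shiftedMatrix, hermitianMatrix, splitBorder]
  · refine Finset.sum_congr rfl fun j _ => Finset.sum_congr rfl fun i _ => ?_
    have hrow : shiftedMatrix x s 0 j.succ = toComplex ((splitBorder x).2.2 j) := by
      simp [shiftedMatrix, hermitianMatrix, splitBorder, toComplex, (Fin.succ_ne_zero j).symm]
    have hcol : shiftedMatrix x s i.succ 0 =
        (starRingEnd ℂ) (toComplex ((splitBorder x).2.2 i)) := by
      rw [conj_toComplex]
      simp [shiftedMatrix, hermitianMatrix, splitBorder, Fin.succ_ne_zero i]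
    rw [hrow, hcol]

/-- The correlation function of the characteristic determinant for complex arguments. -/
noncomputable def pairCorrelation (N : ℕ) (Q : Measure ℝ) (s t : ℂ) : ℂ :=
  ∫ x : Index N → ℝ, (shiftedMatrix x s).det * (shiftedMatrix x t).det ∂Measure.pi fun _ => Q

theorem pairCorrelation_comm (N : ℕ) (Q : Measure ℝ) (s t : ℂ) :
    pairCorrelation N Q s t = pairCorrelation N Q t s := by
  simp only [pairCorrelation, mul_comm]

/-- The correlation of the traced adjugate with the characteristic determinant. -/
noncomputable def traceCorrelation (N : ℕ) (Q : Measure ℝ) (s t : ℂ) : ℂ :=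
  ∫ x : Index N → ℝ, (shiftedMatrix x s).adjugate.trace * (shiftedMatrix x t).det
    ∂Measure.pi fun _ => Q

/-- The correlation of two traced adjugates. -/
noncomputable def traceTraceCorrelation (N : ℕ) (Q : Measure ℝ) (s t : ℂ) : ℂ :=
  ∫ x : Index N → ℝ, (shiftedMatrix x s).adjugate.trace * (shiftedMatrix x t).adjugate.trace
    ∂Measure.pi fun _ => Q

theorem continuous_det_shiftedMatrix (z : ℂ) :
    Continuous fun x : Index N → ℝ => (shiftedMatrix x z).det :=
  (continuous_shiftedMatrix z).matrix_det

theorem continuous_adjugate_shiftedMatrix (z : ℂ) :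
    Continuous fun x : Index N → ℝ => (shiftedMatrix x z).adjugate :=
  (continuous_shiftedMatrix z).matrix_adjugate

theorem continuous_trace_adjugate_shiftedMatrix (z : ℂ) :
    Continuous fun x : Index N → ℝ => (shiftedMatrix x z).adjugate.trace :=
  (continuous_adjugate_shiftedMatrix z).matrix_trace

variable {Q : Measure ℝ} [IsProbabilityMeasure Q] {b : ℝ}

theorem integrable_det_mul_det (hfin : Integrable (fun x : ℝ => x ^ 4) Q) (s t : ℂ) :
    Integrable (fun x : Index N → ℝ => (shiftedMatrix x s).det * (shiftedMatrix x t).det)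
      (Measure.pi fun _ => Q) :=
  integrable_mul_of_norm_le_weight hfin (continuous_det_shiftedMatrix s)
    (continuous_det_shiftedMatrix t) (fun x => norm_det_shiftedMatrix_le x s)
    fun x => norm_det_shiftedMatrix_le x t

theorem integrable_trace_mul_det (hfin : Integrable (fun x : ℝ => x ^ 4) Q) (s t : ℂ) :
    Integrable (fun x : Index N → ℝ => (shiftedMatrix x s).adjugate.trace *
      (shiftedMatrix x t).det) (Measure.pi fun _ => Q) :=
  integrable_mul_of_norm_le_weight hfin (continuous_trace_adjugate_shiftedMatrix s)
    (continuous_det_shiftedMatrix t) (fun x => norm_trace_adjugate_shiftedMatrix_le x s)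
    fun x => norm_det_shiftedMatrix_le x t

theorem integrable_trace_mul_trace (hfin : Integrable (fun x : ℝ => x ^ 4) Q) (s t : ℂ) :
    Integrable (fun x : Index N → ℝ => (shiftedMatrix x s).adjugate.trace *
      (shiftedMatrix x t).adjugate.trace) (Measure.pi fun _ => Q) :=
  integrable_mul_of_norm_le_weight hfin (continuous_trace_adjugate_shiftedMatrix s)
    (continuous_trace_adjugate_shiftedMatrix t)
    (fun x => norm_trace_adjugate_shiftedMatrix_le x s)
    fun x => norm_trace_adjugate_shiftedMatrix_le x t

theorem integrable_adjugate_mul_adjugate (hfin : Integrable (fun x : ℝ => x ^ 4) Q) (s t : ℂ)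
    (i : Fin N) : Integrable (fun x : Index N → ℝ => (shiftedMatrix x s).adjugate i i *
      (shiftedMatrix x t).adjugate i i) (Measure.pi fun _ => Q) :=
  integrable_mul_of_norm_le_weight hfin ((continuous_adjugate_shiftedMatrix s).matrix_elem i i)
    ((continuous_adjugate_shiftedMatrix t).matrix_elem i i)
    (fun x => norm_adjugate_shiftedMatrix_le x s i i)
    fun x => norm_adjugate_shiftedMatrix_le x t i i

/-- Differentiation of the characteristic determinant under the expectation. -/
theorem hasDerivAt_integral_mul_det (hfin : Integrable (fun x : ℝ => x ^ 4) Q)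
    {g : (Index N → ℝ) → ℂ} (hg : Continuous g) {C : ℝ} (hC : ∀ x, ‖g x‖ ≤ C * weight x ^ 2)
    (s : ℂ) :
    HasDerivAt (fun s => ∫ x, g x * (shiftedMatrix x s).det ∂(Measure.pi fun _ => Q))
      (-∫ x, g x * (shiftedMatrix x s).adjugate.trace ∂(Measure.pi fun _ => Q)) s := by
  have hd : ∀ s, Integrable (fun x => g x * (shiftedMatrix x s).det) (Measure.pi fun _ => Q) :=
    fun s => integrable_mul_of_norm_le_weight hfin hg (continuous_det_shiftedMatrix s) hC
      fun x => norm_det_shiftedMatrix_le x s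
  have h := hasDerivAt_integral_of_dominated_loc_of_deriv_le
    (μ := (Measure.pi fun _ => Q : Measure (Index N → ℝ)))
    (F := fun (s : ℂ) x => g x * (shiftedMatrix x s).det)
    (F' := fun (s : ℂ) x => -(g x * (shiftedMatrix x s).adjugate.trace))
    (bound := fun x => (C * (N * (N.factorial * (2 + (‖s‖ + 1)) ^ N))) * weight x ^ 4)
    (x₀ := s) (Metric.ball_mem_nhds s one_pos)
    (Eventually.of_forall fun s => (hd s).aestronglyMeasurable) (hd s)
    (hg.mul (continuous_trace_adjugate_shiftedMatrix s)).neg.aestronglyMeasurable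
    (Eventually.of_forall fun x z hz => ?_)
    ((integrable_weight_pow_four hfin).const_mul _)
    (Eventually.of_forall fun x z _ => ?_)
  · have h2 := h.2
    rw [integral_neg] at h2
    exact h2
  · have hz' : ‖z‖ ≤ ‖s‖ + 1 := by
      rw [Metric.mem_ball, dist_eq_norm] at hz
      have := norm_add_le s (z - s)
      rw [add_sub_cancel] at this
      linarith
    rw [norm_neg, norm_mul]
    have h0 : 0 ≤ C * weight x ^ 2 := (norm_nonneg _).trans (hC x)
    calc _ ≤ (C * weight x ^ 2) * (N * (N.factorial * (2 + ‖z‖) ^ N) * weight x ^ 2) :=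
          mul_le_mul (hC x) (norm_trace_adjugate_shiftedMatrix_le x z) (norm_nonneg _) h0
      _ ≤ (C * weight x ^ 2) * (N * (N.factorial * (2 + (‖s‖ + 1)) ^ N) * weight x ^ 2) := by
          gcongr
      _ = _ := by ring
  · exact ((hasDerivAt_det_sub_smul_one (hermitianMatrix x) z).const_mul (g x)).congr_deriv
      (by rw [mul_neg]; rfl)

theorem hasDerivAt_pairCorrelation_right (hfin : Integrable (fun x : ℝ => x ^ 4) Q) (s t : ℂ) :
    HasDerivAt (fun t => pairCorrelation N Q s t) (-traceCorrelation N Q t s) t := by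
  refine (hasDerivAt_integral_mul_det hfin (continuous_det_shiftedMatrix s)
    (fun x => norm_det_shiftedMatrix_le x s) t).congr_deriv ?_
  simp only [traceCorrelation, mul_comm]

theorem hasDerivAt_pairCorrelation_left (hfin : Integrable (fun x : ℝ => x ^ 4) Q) (s t : ℂ) :
    HasDerivAt (fun s => pairCorrelation N Q s t) (-traceCorrelation N Q s t) s := by
  simp_rw [fun s => pairCorrelation_comm N Q s t]
  exact hasDerivAt_pairCorrelation_right hfin t s

theorem hasDerivAt_traceCorrelation_right (hfin : Integrable (fun x : ℝ => x ^ 4) Q) (s t : ℂ) :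
    HasDerivAt (fun t => traceCorrelation N Q s t) (-traceTraceCorrelation N Q s t) t :=
  hasDerivAt_integral_mul_det hfin (continuous_trace_adjugate_shiftedMatrix s)
    (fun x => norm_trace_adjugate_shiftedMatrix_le x s) t

/-- A principal minor of a Wigner matrix is again a Wigner matrix. -/
theorem sum_integral_adjugate_mul_adjugate (s t : ℂ) :
    ∑ i : Fin N, ∫ x : Index N → ℝ, (shiftedMatrix x s).adjugate i i *
      (shiftedMatrix x t).adjugate i i ∂(Measure.pi fun _ => Q) =
      N * pairCorrelation (N - 1) Q s t := by
  match N with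
  | 0 => simp
  | n + 1 =>
    have h : ∀ i : Fin (n + 1), ∫ x : Index (n + 1) → ℝ, (shiftedMatrix x s).adjugate i i *
        (shiftedMatrix x t).adjugate i i ∂(Measure.pi fun _ => Q) = pairCorrelation n Q s t := by
      intro i
      have hmp := measurePreserving_comp_injective Q (Index.map_injective (Fin.succAboveOrderEmb i))
      unfold pairCorrelation
      have hc : Continuous fun x : Index n → ℝ =>
          (shiftedMatrix x s).det * (shiftedMatrix x t).det :=
        (continuous_det_shiftedMatrix s).mul (continuous_det_shiftedMatrix t)
      rw [← hmp.map_eq, integral_map hmp.measurable.aemeasurable hc.aestronglyMeasurable]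
      congr 1
      ext x
      rw [shiftedMatrix_comp_map, shiftedMatrix_comp_map, adjugate_diag_eq_det_submatrix,
        adjugate_diag_eq_det_submatrix]
      rfl
    simp [h]

/-- The correlation function after averaging over the first row. -/
theorem pairCorrelation_succ_eq_integral (hmean : ∫ x, x ∂Q = 0)
    (hvar : ∫ x, x ^ 2 ∂Q = 1 / 2) (hfin : Integrable (fun x : ℝ => x ^ 4) Q)
    (hb : ∫ x, x ^ 4 ∂Q = b) (s t : ℂ) :
    pairCorrelation (N + 1) Q s t = ∫ y : Index N → ℝ,
      ((1 + s * t) * ((shiftedMatrix y s).det * (shiftedMatrix y t).det) +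
        s * ((shiftedMatrix y s).det * (shiftedMatrix y t).adjugate.trace) +
        t * ((shiftedMatrix y t).det * (shiftedMatrix y s).adjugate.trace) +
        (shiftedMatrix y s).adjugate.trace * (shiftedMatrix y t).adjugate.trace +
        ((shiftedMatrix y s).adjugate * (shiftedMatrix y t).adjugate).trace +
        2 * (b - 3 / 4) * ∑ i, (shiftedMatrix y s).adjugate i i * (shiftedMatrix y t).adjugate i i)
      ∂(Measure.pi fun _ => Q) := by
  set P : (Index N → ℝ) × (ℝ × (Fin N → ℝ × ℝ)) → ℂ := fun p =>
    borderDet s (shiftedMatrix p.1 s).det (shiftedMatrix p.1 s).adjugate p.2 *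
      borderDet t (shiftedMatrix p.1 t).det (shiftedMatrix p.1 t).adjugate p.2 with hP
  have hmp := measurePreserving_splitBorder (N := N) Q
  have hbd : ∀ z : ℂ, Continuous fun p : (Index N → ℝ) × (ℝ × (Fin N → ℝ × ℝ)) =>
      borderDet z (shiftedMatrix p.1 z).det (shiftedMatrix p.1 z).adjugate p.2 := by
    intro z
    have h1 := (continuous_det_shiftedMatrix (N := N) z).comp
      (continuous_fst (X := Index N → ℝ) (Y := ℝ × (Fin N → ℝ × ℝ)))
    have h2 : ∀ i j, Continuous fun p : (Index N → ℝ) × (ℝ × (Fin N → ℝ × ℝ)) =>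
        (shiftedMatrix p.1 z).adjugate i j := fun i j =>
      ((continuous_adjugate_shiftedMatrix (N := N) z).matrix_elem i j).comp continuous_fst
    have h3 : ∀ i, Continuous fun p : (Index N → ℝ) × (ℝ × (Fin N → ℝ × ℝ)) =>
        toComplex (p.2.2 i) := fun i => continuous_toComplex.comp (by fun_prop)
    unfold borderDet borderForm
    refine Continuous.sub (Continuous.mul (by fun_prop) h1) ?_
    exact continuous_finsetSum _ fun j _ => continuous_finsetSum _ fun i _ =>
      (h2 j i).mul ((h3 j).mul (Complex.continuous_conj.comp (h3 i)))
  have hPc : Continuous P := (hbd s).mul (hbd t)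
  have hPs : ∀ x, P (splitBorder x) = (shiftedMatrix x s).det * (shiftedMatrix x t).det :=
    fun x => by rw [det_shiftedMatrix_succ, det_shiftedMatrix_succ]
  have hint : Integrable P ((Measure.pi fun _ : Index N => Q).prod
      (Q.prod (Measure.pi fun _ : Fin N => Q.prod Q))) := by
    rw [← hmp.integrable_comp hPc.aestronglyMeasurable]
    exact (integrable_det_mul_det hfin s t).congr (Eventually.of_forall fun x => (hPs x).symm)
  unfold pairCorrelation
  simp_rw [← hPs]
  rw [← integral_map hmp.measurable.aemeasurable hPc.aestronglyMeasurable, hmp.map_eq,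
    integral_prod _ hint]
  refine integral_congr_ae (Eventually.of_forall fun y => ?_)
  simp only [hP]
  rw [integral_borderDet_mul hmean hvar hfin hb]

/-- The recursion for the correlation function obtained by averaging over the first row. -/
theorem pairCorrelation_succ (hmean : ∫ x, x ∂Q = 0) (hvar : ∫ x, x ^ 2 ∂Q = 1 / 2)
    (hfin : Integrable (fun x : ℝ => x ^ 4) Q) (hb : ∫ x, x ^ 4 ∂Q = b) (s t : ℂ) :
    (s - t) * pairCorrelation (N + 1) Q s t =
      (s - t) * ((1 + s * t) * pairCorrelation N Q s t + s * traceCorrelation N Q t s +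
        t * traceCorrelation N Q s t + traceTraceCorrelation N Q s t) +
      (traceCorrelation N Q s t - traceCorrelation N Q t s) +
      2 * (b - 3 / 4) * N * ((s - t) * pairCorrelation (N - 1) Q s t) := by
  have hres : ∀ y : Index N → ℝ,
      (s - t) * ((shiftedMatrix y s).adjugate * (shiftedMatrix y t).adjugate).trace =
      (shiftedMatrix y s).adjugate.trace * (shiftedMatrix y t).det -
        (shiftedMatrix y t).adjugate.trace * (shiftedMatrix y s).det := by
    intro y
    have h := congrArg Matrix.trace (smul_adjugate_mul_adjugate (hermitianMatrix y) s t)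
    rw [Matrix.trace_smul, Matrix.trace_sub, Matrix.trace_smul, Matrix.trace_smul] at h
    simp only [smul_eq_mul] at h
    unfold shiftedMatrix
    linear_combination -h
  have i1 := (integrable_det_mul_det (N := N) hfin s t).const_mul ((s - t) * (1 + s * t))
  have i2 := (integrable_trace_mul_det (N := N) hfin t s).const_mul ((s - t) * s - 1)
  have i3 := (integrable_trace_mul_det (N := N) hfin s t).const_mul ((s - t) * t + 1)
  have i4 := (integrable_trace_mul_trace (N := N) hfin s t).const_mul (s - t)
  have i5 := (integrable_finsetSum Finset.univ fun i _ =>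
    integrable_adjugate_mul_adjugate (N := N) hfin s t i).const_mul ((s - t) * (2 * (b - 3 / 4)))
  have e : ∀ y : Index N → ℝ, (s - t) *
      ((1 + s * t) * ((shiftedMatrix y s).det * (shiftedMatrix y t).det) +
        s * ((shiftedMatrix y s).det * (shiftedMatrix y t).adjugate.trace) +
        t * ((shiftedMatrix y t).det * (shiftedMatrix y s).adjugate.trace) +
        (shiftedMatrix y s).adjugate.trace * (shiftedMatrix y t).adjugate.trace +
        ((shiftedMatrix y s).adjugate * (shiftedMatrix y t).adjugate).trace +
        2 * (b - 3 / 4) *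
          ∑ i, (shiftedMatrix y s).adjugate i i * (shiftedMatrix y t).adjugate i i) =
      (s - t) * (1 + s * t) * ((shiftedMatrix y s).det * (shiftedMatrix y t).det) +
      ((s - t) * s - 1) * ((shiftedMatrix y t).adjugate.trace * (shiftedMatrix y s).det) +
      ((s - t) * t + 1) * ((shiftedMatrix y s).adjugate.trace * (shiftedMatrix y t).det) +
      (s - t) * ((shiftedMatrix y s).adjugate.trace * (shiftedMatrix y t).adjugate.trace) +
      (s - t) * (2 * (b - 3 / 4)) *
        ∑ i, (shiftedMatrix y s).adjugate i i * (shiftedMatrix y t).adjugate i i :=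
    fun y => by linear_combination hres y
  rw [pairCorrelation_succ_eq_integral hmean hvar hfin hb, ← integral_const_mul]
  simp_rw [e]
  rw [integral_add (((i1.fun_add i2).fun_add i3).fun_add i4) i5,
    integral_add ((i1.fun_add i2).fun_add i3) i4, integral_add (i1.fun_add i2) i3,
    integral_add i1 i2, integral_const_mul, integral_const_mul, integral_const_mul,
    integral_const_mul, integral_const_mul,
    integral_finsetSum _ fun i _ => integrable_adjugate_mul_adjugate hfin s t i,
    sum_integral_adjugate_mul_adjugate]
  unfold pairCorrelation traceCorrelation traceTraceCorrelation
  ring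

end Correlations

/-- The image of `hermiteCross` under raising in the first variable. -/
noncomputable def hermiteRaised (n : ℕ) (s t : ℂ) : ℂ :=
  hermiteEval (n + 2) s * hermiteEval n t - hermiteEval (n + 1) s * hermiteEval (n + 1) t

theorem hasDerivAt_hermiteCross_left (n : ℕ) (s t : ℂ) :
    HasDerivAt (fun s => hermiteCross n s t) (s * hermiteCross n s t - hermiteRaised n s t) s := by
  refine (((hasDerivAt_hermiteEval (n + 1) s).mul_const (hermiteEval n t)).sub
    ((hasDerivAt_hermiteEval n s).mul_const (hermiteEval (n + 1) t))).congr_deriv ?_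
  unfold hermiteCross hermiteRaised
  ring

theorem hasDerivAt_hermiteRaised_right (n : ℕ) (s t : ℂ) :
    HasDerivAt (fun t => hermiteRaised n s t)
      (t * hermiteRaised n s t - hermiteCross (n + 1) s t) t := by
  refine (((hasDerivAt_hermiteEval n t).const_mul (hermiteEval (n + 2) s)).sub
    ((hasDerivAt_hermiteEval (n + 1) t).const_mul (hermiteEval (n + 1) s))).congr_deriv ?_
  unfold hermiteCross hermiteRaised
  ring

/-- The joint law of an i.i.d. family of matrix variables. -/
theorem map_eq_pi {Q : Measure ℝ} {N : ℕ} {Ω : Type*} [MeasurableSpace Ω] {P : Measure Ω}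
    {ξ : Index N → Ω → ℝ} (hlaw : ∀ k, HasLaw (ξ k) Q P) (hindep : iIndepFun ξ P) :
    P.map (fun ω k => ξ k ω) = Measure.pi fun _ => Q := by
  rw [hindep.map_fun_eq_pi_map fun k => (hlaw k).aemeasurable]
  congr 1
  ext1 k
  exact (hlaw k).map_eq

theorem correlation_eq_pairCorrelation {Q : Measure ℝ} {N : ℕ} {Ω : Type*} [MeasurableSpace Ω]
    {P : Measure Ω}
    {ξ : Index N → Ω → ℝ} (hlaw : ∀ k, HasLaw (ξ k) Q P) (hindep : iIndepFun ξ P) (s t : ℝ) :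
    correlation P ξ s t = pairCorrelation N Q s t := by
  have hm : AEMeasurable (fun ω k => ξ k ω) P :=
    aemeasurable_pi_lambda _ fun k => (hlaw k).aemeasurable
  have hc : Continuous fun x : Index N → ℝ =>
      (shiftedMatrix x s).det * (shiftedMatrix x t).det :=
    (continuous_det_shiftedMatrix s).mul (continuous_det_shiftedMatrix t)
  unfold pairCorrelation
  rw [← map_eq_pi hlaw hindep, integral_map hm hc.aestronglyMeasurable]
  rfl

section Recursion

variable {Q : Measure ℝ} [IsProbabilityMeasure Q] {b : ℝ} {N : ℕ}

/-- The differential operator in the recursion raises the degree of the Hermite expansion. -/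
theorem raise_hermite_expansion (hfin : Integrable (fun x : ℝ => x ^ 4) Q) (S : Finset ℕ)
    (c : ℕ → ℂ) (n : ℕ → ℕ)
    (h : ∀ s t, (s - t) * pairCorrelation N Q s t = ∑ k ∈ S, c k * hermiteCross (n k) s t)
    (s t : ℂ) :
    (s - t) * ((1 + s * t) * pairCorrelation N Q s t + s * traceCorrelation N Q t s +
        t * traceCorrelation N Q s t + traceTraceCorrelation N Q s t) +
      (traceCorrelation N Q s t - traceCorrelation N Q t s) =
      ∑ k ∈ S, c k * hermiteCross (n k + 1) s t := by
  have h1 : ∀ s t, s * ((s - t) * pairCorrelation N Q s t) - (pairCorrelation N Q s t -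
      (s - t) * traceCorrelation N Q s t) = ∑ k ∈ S, c k * hermiteRaised (n k) s t := by
    intro s t
    have d1 := ((hasDerivAt_id s).sub_const t).mul
      (hasDerivAt_pairCorrelation_left (N := N) hfin s t)
    have d2 := HasDerivAt.fun_sum (u := S) fun k _ =>
      (hasDerivAt_hermiteCross_left (n k) s t).const_mul (c k)
    have d3 := (d2.congr_of_eventuallyEq (Eventually.of_forall fun s => h s t)).unique d1
    simp only [mul_sub, Finset.sum_sub_distrib, id] at d3
    have e : ∑ k ∈ S, c k * (s * hermiteCross (n k) s t) =
        s * ((s - t) * pairCorrelation N Q s t) := by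
      rw [h, Finset.mul_sum]
      exact Finset.sum_congr rfl fun k _ => by ring
    rw [e] at d3
    linear_combination d3
  have d1 := ((((hasDerivAt_id t).const_sub s).mul
    (hasDerivAt_pairCorrelation_right (N := N) hfin s t)).const_mul s).sub
    ((hasDerivAt_pairCorrelation_right (N := N) hfin s t).sub
      (((hasDerivAt_id t).const_sub s).mul
        (hasDerivAt_traceCorrelation_right (N := N) hfin s t)))
  have d2 := HasDerivAt.fun_sum (u := S) fun k _ =>
    (hasDerivAt_hermiteRaised_right (n k) s t).const_mul (c k)
  have d3 := (d2.congr_of_eventuallyEq (Eventually.of_forall fun t => h1 s t)).unique d1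
  simp only [mul_sub, Finset.sum_sub_distrib, id] at d3
  have e : ∑ k ∈ S, c k * (t * hermiteRaised (n k) s t) =
      t * (s * ((s - t) * pairCorrelation N Q s t) - (pairCorrelation N Q s t -
        (s - t) * traceCorrelation N Q s t)) := by
    rw [h1, Finset.mul_sum]
    exact Finset.sum_congr rfl fun k _ => by ring
  rw [e] at d3
  linear_combination d3

/-- The coefficients of the Hermite expansion of the correlation function. -/
noncomputable def expansionCoeff (β : ℂ) (N k : ℕ) : ℂ :=
  β ^ k / k.factorial * N.descFactorial (2 * k)

theorem expansionCoeff_zero_right (β : ℂ) (N : ℕ) : expansionCoeff β N 0 = 1 := by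
  simp [expansionCoeff]

theorem expansionCoeff_of_lt (β : ℂ) {N k : ℕ} (h : N < 2 * k) : expansionCoeff β N k = 0 := by
  simp [expansionCoeff, Nat.descFactorial_of_lt h]

theorem expansionCoeff_succ (β : ℂ) (N k : ℕ) :
    expansionCoeff β (N + 1) (k + 1) =
      expansionCoeff β N (k + 1) + 2 * β * N * expansionCoeff β (N - 1) k := by
  have h1 : ((N + 1).descFactorial (2 * (k + 1)) : ℂ) =
      N.descFactorial (2 * (k + 1)) + (2 * k + 2) * (N * (N - 1).descFactorial (2 * k)) := by
    have e1 : ((N : ℂ) * (N - 1).descFactorial (2 * k)) = N.descFactorial (2 * k + 1) := by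
      cases N with
      | zero => simp
      | succ n => rw [Nat.succ_descFactorial_succ]; simp
    rw [e1, show 2 * (k + 1) = 2 * k + 1 + 1 by ring, Nat.succ_descFactorial_succ,
      Nat.descFactorial_succ N (2 * k + 1)]
    rcases lt_or_ge N (2 * k + 1) with h | h
    · rw [Nat.descFactorial_of_lt h]
      simp
    · push_cast [Nat.cast_sub h]
      ring
  unfold expansionCoeff
  have hk : ((k.factorial : ℕ) : ℂ) ≠ 0 := by exact_mod_cast k.factorial_ne_zero
  have hk1 : (k : ℂ) + 1 ≠ 0 := by exact_mod_cast k.succ_ne_zero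
  rw [h1, Nat.factorial_succ]
  push_cast
  field_simp
  ring

theorem sum_expansionCoeff_succ (β : ℂ) (N : ℕ) (w : ℕ → ℂ) :
    ∑ k ∈ Finset.range (N + 2), expansionCoeff β (N + 1) k * w (N + 1 - 2 * k) =
      ∑ k ∈ Finset.range (N + 1), expansionCoeff β N k * w (N - 2 * k + 1) +
        2 * β * N * ∑ k ∈ Finset.range (N - 1 + 1),
          expansionCoeff β (N - 1) k * w (N - 1 - 2 * k) := by
  have hext : (N : ℂ) * ∑ k ∈ Finset.range (N - 1 + 1),
      expansionCoeff β (N - 1) k * w (N - 1 - 2 * k) =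
      N * ∑ k ∈ Finset.range (N + 1), expansionCoeff β (N - 1) k * w (N - 1 - 2 * k) := by
    cases N with
    | zero => simp
    | succ n =>
      congr 1
      rw [Finset.sum_range_succ _ (n + 1), expansionCoeff_of_lt β (by omega)]
      simp
  have hext2 : ∑ k ∈ Finset.range (N + 1), expansionCoeff β N k * w (N - 2 * k + 1) =
      ∑ k ∈ Finset.range (N + 2), expansionCoeff β N k * w (N - 2 * k + 1) := by
    rw [Finset.sum_range_succ _ (N + 1), expansionCoeff_of_lt β (by omega)]
    simp
  rw [mul_assoc, hext, hext2, Finset.sum_range_succ', Finset.sum_range_succ' _ (N + 1),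
    expansionCoeff_zero_right, expansionCoeff_zero_right, ← mul_assoc, Finset.mul_sum,
    add_right_comm, ← Finset.sum_add_distrib]
  congr 1
  refine Finset.sum_congr rfl fun k _ => ?_
  rw [expansionCoeff_succ, show N + 1 - 2 * (k + 1) = N - 1 - 2 * k by omega]
  rcases lt_or_ge N (2 * (k + 1)) with h | h
  · rw [expansionCoeff_of_lt β h]
    ring
  · rw [show N - 2 * (k + 1) + 1 = N - 1 - 2 * k by omega]
    ring

theorem sub_mul_pairCorrelation (hmean : ∫ x, x ∂Q = 0) (hvar : ∫ x, x ^ 2 ∂Q = 1 / 2)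
    (hfin : Integrable (fun x : ℝ => x ^ 4) Q) (hb : ∫ x, x ^ 4 ∂Q = b) (N : ℕ) (s t : ℂ) :
    (s - t) * pairCorrelation N Q s t = ∑ k ∈ Finset.range (N + 1),
      expansionCoeff (b - 3 / 4) N k * hermiteCross (N - 2 * k) s t := by
  induction N using Nat.strong_induction_on generalizing s t with
  | _ M ih =>
    cases M with
    | zero => simp [pairCorrelation, expansionCoeff, hermiteCross]
    | succ N =>
      rw [pairCorrelation_succ hmean hvar hfin hb,
        raise_hermite_expansion hfin _ _ _ (ih N (Nat.lt_succ_self N)),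
        ih (N - 1) (by omega), sum_expansionCoeff_succ _ N fun m => hermiteCross m s t]

theorem expansionCoeff_mul_factorial (β : ℂ) {N k : ℕ} (h : 2 * k ≤ N) :
    expansionCoeff β N k * (N - 2 * k).factorial = N.factorial * (β ^ k / k.factorial) := by
  rw [expansionCoeff, ← Nat.factorial_mul_descFactorial h]
  push_cast
  ring

theorem sub_mul_pairCorrelation_eq_kernel (hmean : ∫ x, x ∂Q = 0) (hvar : ∫ x, x ^ 2 ∂Q = 1 / 2)
    (hfin : Integrable (fun x : ℝ => x ^ 4) Q) (hb : ∫ x, x ^ 4 ∂Q = b) (N : ℕ) (s t : ℂ) :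
    (s - t) * pairCorrelation N Q s t = (s - t) * (N.factorial *
      ∑ k ∈ Finset.range (N / 2 + 1),
        (b - 3 / 4 : ℂ) ^ k / k.factorial * hermiteKernel (N - 2 * k) s t) := by
  rw [sub_mul_pairCorrelation hmean hvar hfin hb, Finset.mul_sum, Finset.mul_sum]
  symm
  refine (Finset.sum_congr rfl fun k hk => ?_).trans
    (Finset.sum_subset (Finset.range_mono (by omega)) fun k _ hk => ?_)
  · have h2 : 2 * k ≤ N := by
      have := Finset.mem_range.1 hk
      omega
    rw [← christoffel_darboux]
    linear_combination (-(s - t) * hermiteKernel (N - 2 * k) s t) *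
      expansionCoeff_mul_factorial (b - 3 / 4 : ℂ) h2
  · rw [Finset.mem_range] at hk
    rw [expansionCoeff_of_lt _ (by omega), zero_mul]

/-- The correlation function is a combination of Hermite kernels. -/
theorem pairCorrelation_eq (hmean : ∫ x, x ∂Q = 0) (hvar : ∫ x, x ^ 2 ∂Q = 1 / 2)
    (hfin : Integrable (fun x : ℝ => x ^ 4) Q) (hb : ∫ x, x ^ 4 ∂Q = b) (N : ℕ) (s t : ℂ) :
    pairCorrelation N Q s t = N.factorial * ∑ k ∈ Finset.range (N / 2 + 1),
        (b - 3 / 4 : ℂ) ^ k / k.factorial * hermiteKernel (N - 2 * k) s t := by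
  have c1 : Continuous fun s => pairCorrelation N Q s t := continuous_iff_continuousAt.2 fun s =>
    (hasDerivAt_pairCorrelation_left hfin s t).continuousAt
  have c2 : Continuous fun s : ℂ => (N.factorial : ℂ) * ∑ k ∈ Finset.range (N / 2 + 1),
        (b - 3 / 4 : ℂ) ^ k / k.factorial * hermiteKernel (N - 2 * k) s t := by
    have := continuous_hermiteEval
    unfold hermiteKernel
    fun_prop
  refine congrFun (c1.ext_on (dense_compl_singleton t) c2 fun s hs => ?_) s
  exact mul_left_cancel₀ (sub_ne_zero.2 hs)
    (sub_mul_pairCorrelation_eq_kernel hmean hvar hfin hb N s t)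

theorem integrable_charDet_mul {Ω : Type*} [MeasurableSpace Ω] {P : Measure Ω}
    (hfin : Integrable (fun x : ℝ => x ^ 4) Q)
    {ξ : Index N → Ω → ℝ} (hlaw : ∀ k, HasLaw (ξ k) Q P) (hindep : iIndepFun ξ P) (s t : ℝ) :
    Integrable (fun ω => charDet (fun k => ξ k ω) s * charDet (fun k => ξ k ω) t) P := by
  have hm : AEMeasurable (fun ω k => ξ k ω) P :=
    aemeasurable_pi_lambda _ fun k => (hlaw k).aemeasurable
  have h := integrable_det_mul_det (N := N) hfin s t
  rw [← map_eq_pi hlaw hindep] at h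
  exact h.comp_aemeasurable hm

end Recursion

end WignerEdge

theorem theorem1
    (Q : Measure ℝ) [IsProbabilityMeasure Q] (b : ℝ)
    (hmean : ∫ x, x ∂Q = 0)
    (hvar : ∫ x, x ^ 2 ∂Q = 1 / 2)
    (hfin : Integrable (fun x : ℝ => x ^ 4) Q)
    (hb : ∫ x, x ^ 4 ∂Q = b)
    (Ω : ℕ → Type*) [∀ N, MeasurableSpace (Ω N)]
    (P : ∀ N, Measure (Ω N)) [∀ N, IsProbabilityMeasure (P N)]
    (ξ : ∀ N, WignerEdge.Index N → Ω N → ℝ)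
    (hlaw : ∀ N k, HasLaw (ξ N k) Q (P N))
    (hindep : ∀ N, iIndepFun (ξ N) (P N)) :
    Continuous (fun p : ℝ × ℝ => WignerEdge.airyKernel p.1 p.2) ∧
    (∀ (N : ℕ) (s t : ℝ), Integrable
      (fun ω => WignerEdge.charDet (fun k => ξ N k ω) s *
        WignerEdge.charDet (fun k => ξ N k ω) t) (P N)) ∧
    ∀ μ ν : ℝ, Tendsto
      (fun N : ℕ =>
        (((Real.sqrt (2 * Real.pi) * (N.factorial : ℝ) * (N : ℝ) ^ (1 / 6 : ℝ) *
            Real.exp (2 * (N : ℝ) + (μ + ν) * (N : ℝ) ^ (1 / 3 : ℝ)))⁻¹ : ℝ) : ℂ) *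
          WignerEdge.correlation (P N) (ξ N)
            (2 * Real.sqrt (N : ℝ) + μ * (N : ℝ) ^ (-(1 / 6) : ℝ))
            (2 * Real.sqrt (N : ℝ) + ν * (N : ℝ) ^ (-(1 / 6) : ℝ)))
      atTop
      (𝓝 ((Real.exp (b - 3 / 4) * WignerEdge.airyKernel μ ν : ℝ) : ℂ)) := by
  refine ⟨WignerEdge.continuous_airyKernel, fun N s t =>
    WignerEdge.integrable_charDet_mul hfin (hlaw N) (hindep N) s t, fun μ ν => ?_⟩
  have h := (Complex.continuous_ofReal.tendsto _).comp
    (WignerEdge.tendsto_sum_hermiteKernel_edgePoint (b - 3 / 4) μ ν)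
  refine h.congr' ?_
  filter_upwards [eventually_gt_atTop 0] with N hN
  have hf : (N.factorial : ℝ) ≠ 0 := by exact_mod_cast N.factorial_ne_zero
  have hpt : ∀ x : ℝ, 2 * √(N : ℝ) + x * (N : ℝ) ^ (-(1 / 6) : ℝ) = WignerEdge.edgePoint N x := by
    intro x
    rw [WignerEdge.sqrt_eq_edgeScale, WignerEdge.rpow_neg_eq_edgeScale, WignerEdge.edgePoint]
  have hnorm : √(2 * Real.pi) * (N.factorial : ℝ) * (N : ℝ) ^ (1 / 6 : ℝ) *
      Real.exp (2 * (N : ℝ) + (μ + ν) * (N : ℝ) ^ (1 / 3 : ℝ)) =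
      N.factorial * WignerEdge.edgeNorm N μ ν := by
    rw [WignerEdge.rpow_third_eq_edgeScale, WignerEdge.edgeNorm, WignerEdge.edgeScale]
    ring
  rw [hpt, hpt, hnorm, WignerEdge.correlation_eq_pairCorrelation (hlaw N) (hindep N),
    WignerEdge.pairCorrelation_eq hmean hvar hfin hb, Function.comp_apply]
  simp only [WignerEdge.hermiteKernel_ofReal]
  push_cast
  have hf' : (N.factorial : ℂ) ≠ 0 := by exact_mod_cast hf
  rw [mul_inv, mul_mul_mul_comm, inv_mul_cancel₀ hf', one_mul, div_eq_inv_mul]
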